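/- Consider the discrete-time system $x_{k+1}=Ax_k+Bu_k$ with $x_k\in\mathbb R^n$, $u_k\in\mathbb R^m$ and $(A,B)$ controllable, and the infinite-horizon LQR cost $$\sum_{k\ge 0}\Big(x_k^\top Qx_k+u_k^\top Ru_k+2x_k^\top Mu_k+(u_k-u_{k-1})^\top\tilde R(u_k-u_{k-1})\Big),\qquad u_{-1}=u_{\rm last},$$ with $W=\begin{bmatrix}Q&M\\M^\top&R\end{bmatrix}\succ0$ and $\tilde R\succ0$. Put $\Phi=\begin{bmatrix}A&B\\0&I\end{bmatrix}$, $\grave Q=\begin{bmatrix}0&0\\0&\tilde R^{-1}\end{bmatrix}$, $\grave R=W^{-1}$, $E=[\,0\;\;I\,]\in\mathbb R^{m\times(n+m)}$, and run the Kalman filter with full measurement $H=I$: $P_0=\grave Q$, $S_k=(P_k+\grave R)^{-1}$, $K_k=P_kS_k$, $P_{k+1}=\Phi(I-K_k)P_k\Phi^\top+\grave Q$. With $\Phi_{-1}=I$ and $\Phi_k=\Phi$ for $k\ge0$, let $G_{-1}=EP_0$, $G_k=G_{k-1}\Phi_{k-1}^\top(I-K_k)^\top$, and for $N\ge0$ let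 $$K_{\rm eff}^{[N]}=G_{-1}S_0+\sum_{k=1}^N G_{k-1}\Phi^\top S_k\,\big[\Phi(I-K_{k-1})\cdots\Phi(I-K_0)\big],\qquad \Delta P_{0[s]}^{[N]}=G_{N-1}\Phi_{N-1}^\top S_N\Phi_{N-1}G_{N-1}^\top,$$ $$P_{0[s]}^{[N]}=E(I-K_0)P_0E^\top-\sum_{k=1}^N\Delta P_{0[s]}^{[k]},\qquad \tau_N=\operatorname{tr}\big(\Delta P_{0[s]}^{[N]}\big)/\operatorname{tr}\big(P_{0[s]}^{[N]}\big).$$ Thus $P_{0[s]}^{[N]}$ is the control block of the smoothed initial covariance (its other blocks vanish), and $\Delta P_{0[s]}^{[N]}$ is its decrease from horizon $N-1$ to horizon $N$ when $N\ge1$. Norms are spectral norms. There is exactly one LQR gain $K_{\rm lqr}$, i.e. one matrix such that from every $(x_0,u_{\rm last})$ some optimal control sequence of the LQR problem has $u_0=u_{\rm last}-K_{\rm lqr}\begin{bmatrix}x_0\\u_{\rm last}\end{bmatrix}$. The limits $K_\infty=\lim K_k$ and $P_{0[s]}^{[\infty]}=\lim P_{0[s]}^{[N]}$ exist, and the largest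 eigenvalue magnitude $\lambda_{\max}$ of $(I-K_\infty)\Phi$ satisfies $\lambda_{\max}<1$. Moreover, with constants depending only on the problem data $A,B,Q,R,M,\tilde R$ (and on $r$ in part 3): 1. There is $\gamma>0$ such that $\|K_{\rm lqr}-K_{\rm eff}^{[N]}\|\le\gamma\operatorname{tr}\big(\Delta P_{0[s]}^{[N]}\big)$ for all sufficiently large $N$, with strict inequality if $\lambda_{\max}>0$. 2. If the eigenvalues of $(I-K_\infty)\Phi$ of magnitude $\lambda_{\max}$ are semisimple, there are $\gamma_k,\gamma_p>0$ such that for all $N\ge0$ $$\|K_{\rm lqr}-K_{\rm eff}^{[N]}\|\le\gamma_k\frac{\lambda_{\max}^{2N}}{1-\lambda_{\max}^2},\qquad \|P_{0[s]}^{[\infty]}-P_{0[s]}^{[N]}\|\le\gamma_p\frac{\lambda_{\max}^{2N}}{1-\lambda_{\max}^2},$$ with strict inequalities if $\lambda_{\max}>0$. 3. Without the semisimplicity assumption, for every $r$ with $\lambda_{\max}<r<1$ there are $\gamma_k,\gamma_p>0$ such that both bounds hold for all $N\ge0$, strictly, with $r$ in place of $\lambda_{\max}$. 4. The termination metric is equivalent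 to the relative gain error: there are $c_1,c_2>0$ such that $\|K_{\rm lqr}-K_{\rm eff}^{[N]}\|\le c_1\tau_N\|K_{\rm lqr}\|$ and $\tau_N\|K_{\rm lqr}\|\le c_2\|K_{\rm lqr}-K_{\rm eff}^{[N]}\|$ for all sufficiently large $N$. -/

import Mathlib

open Filter Topology
open scoped Matrix Matrix.Norms.L2Operator ENNReal

/-- Data of a discrete-time linear-quadratic problem with `n` states and `m` controls:
dynamics `x (k+1) = A x k + B u k`, state weight `Q`, control weight `R`, state-control coupling
weight `M` and control-rate weight `Rt`. -/
structure LqrData (n m : ℕ) where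
  A : Matrix (Fin n) (Fin n) ℝ
  B : Matrix (Fin n) (Fin m) ℝ
  Q : Matrix (Fin n) (Fin n) ℝ
  R : Matrix (Fin m) (Fin m) ℝ
  M : Matrix (Fin n) (Fin m) ℝ
  Rt : Matrix (Fin m) (Fin m) ℝ

namespace LqrData

noncomputable section

variable {n m : ℕ} (s : LqrData n m)

/-- The pair `(A, B)` is controllable: the controllability matrix `[B, AB, …, A^(n-1) B]` has
rank `n`. -/
def Controllable : Prop :=
  (Matrix.of fun (i : Fin n) (p : Fin n × Fin m) => (s.A ^ (p.1 : ℕ) * s.B) i p.2).rank = n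

/-- The joint stage weight `[Q M; Mᵀ R]` on state and control. -/
def weight : Matrix (Fin n ⊕ Fin m) (Fin n ⊕ Fin m) ℝ :=
  Matrix.fromBlocks s.Q s.M s.Mᵀ s.R

/-! ### The infinite-horizon LQR problem (zero reference) -/

/-- State trajectory from `x0` under the control sequence `u`. -/
def traj (x0 : Fin n → ℝ) (u : ℕ → Fin m → ℝ) : ℕ → Fin n → ℝ
  | 0 => x0
  | k + 1 => s.A *ᵥ traj x0 u k + s.B *ᵥ u k

/-- The control applied before time `k`, the one before time `0` being `uLast`. -/
def prevControl (uLast : Fin m → ℝ) (u : ℕ → Fin m → ℝ) : ℕ → Fin m → ℝ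
  | 0 => uLast
  | k + 1 => u k

/-- The cost incurred at time `k`:
`‖x k‖²_Q + ‖u k‖²_R + 2 (x k)ᵀ M (u k) + ‖u k - u (k-1)‖²_Rt`. -/
def stageCost (x0 : Fin n → ℝ) (uLast : Fin m → ℝ) (u : ℕ → Fin m → ℝ) (k : ℕ) : ℝ :=
  s.traj x0 u k ⬝ᵥ (s.Q *ᵥ s.traj x0 u k) + u k ⬝ᵥ (s.R *ᵥ u k)
    + 2 * (s.traj x0 u k ⬝ᵥ (s.M *ᵥ u k))
    + (u k - prevControl uLast u k) ⬝ᵥ (s.Rt *ᵥ (u k - prevControl uLast u k))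

/-- The infinite-horizon cost, possibly `∞` (the stage costs are nonnegative when the weights are
positive definite). -/
def cost (x0 : Fin n → ℝ) (uLast : Fin m → ℝ) (u : ℕ → Fin m → ℝ) : ℝ≥0∞ :=
  ∑' k, ENNReal.ofReal (s.stageCost x0 uLast u k)

/-- `K` is the LQR gain: from every augmented initial state `χ₀ = (x0, uLast)` some optimal control
sequence starts with `u 0 = uLast + K r₀`, where `r₀ = 0 - χ₀` is the initial residual for the zero
reference. -/
def IsLqrGain (K : Matrix (Fin m) (Fin n ⊕ Fin m) ℝ) : Prop :=
  ∀ (x0 : Fin n → ℝ) (uLast : Fin m → ℝ), ∃ u : ℕ → Fin m → ℝ,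
    u 0 = uLast + K *ᵥ (0 - Sum.elim x0 uLast) ∧
    ∀ v : ℕ → Fin m → ℝ, s.cost x0 uLast u ≤ s.cost x0 uLast v

/-! ### The Kalman filter on the augmented state `(x, u)`, with full measurement `H = 1` -/

/-- Augmented system matrix `Φ = [A B; 0 1]`. -/
def Phi : Matrix (Fin n ⊕ Fin m) (Fin n ⊕ Fin m) ℝ :=
  Matrix.fromBlocks s.A s.B 0 1

/-- Process-noise covariance `[0 0; 0 Rt⁻¹]`. -/
def procCov : Matrix (Fin n ⊕ Fin m) (Fin n ⊕ Fin m) ℝ :=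
  Matrix.fromBlocks 0 0 0 s.Rt⁻¹

/-- Measurement-noise covariance `[Q M; Mᵀ R]⁻¹`. -/
def measCov : Matrix (Fin n ⊕ Fin m) (Fin n ⊕ Fin m) ℝ :=
  s.weight⁻¹

/-- Prior covariance: `P 0 = procCov` and `P (k+1) = Φ (1 - K k) (P k) Φᵀ + procCov` with the Kalman
gain `K k = P k (P k + measCov)⁻¹`. -/
def priorCov : ℕ → Matrix (Fin n ⊕ Fin m) (Fin n ⊕ Fin m) ℝ
  | 0 => s.procCov
  | k + 1 =>
    s.Phi * ((1 - priorCov k * (priorCov k + s.measCov)⁻¹) * priorCov k) * s.Phiᵀ + s.procCov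

/-- `S k = (P k + measCov)⁻¹`. -/
def innov (k : ℕ) : Matrix (Fin n ⊕ Fin m) (Fin n ⊕ Fin m) ℝ :=
  (s.priorCov k + s.measCov)⁻¹

/-- Kalman gain `K k = P k * S k`. -/
def kalmanGain (k : ℕ) : Matrix (Fin n ⊕ Fin m) (Fin n ⊕ Fin m) ℝ :=
  s.priorCov k * s.innov k

/-- Posterior covariance `(1 - K k) P k`. -/
def postCov (k : ℕ) : Matrix (Fin n ⊕ Fin m) (Fin n ⊕ Fin m) ℝ :=
  (1 - s.kalmanGain k) * s.priorCov k

/-- The selector `[0 1]` of the control block. -/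
def sel (n m : ℕ) : Matrix (Fin m) (Fin n ⊕ Fin m) ℝ :=
  Matrix.fromCols 0 1

/-- `Φ_{k-1}`, with `Φ_{-1} = 1`. -/
def PhiPrev : ℕ → Matrix (Fin n ⊕ Fin m) (Fin n ⊕ Fin m) ℝ
  | 0 => 1
  | _ + 1 => s.Phi

/-- `GPrev k` is `G_{k-1}`: `G_{-1} = [0 1] P 0` and `G_k = G_{k-1} Φ_{k-1}ᵀ (1 - K k)ᵀ`. -/
def GPrev : ℕ → Matrix (Fin m) (Fin n ⊕ Fin m) ℝ
  | 0 => sel n m * s.priorCov 0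
  | k + 1 => GPrev k * (s.PhiPrev k)ᵀ * (1 - s.kalmanGain k)ᵀ

/-- The product `Φ (1 - K (k-1)) ⋯ Φ (1 - K 0)`. -/
def closedLoopProd : ℕ → Matrix (Fin n ⊕ Fin m) (Fin n ⊕ Fin m) ℝ
  | 0 => 1
  | k + 1 => s.Phi * (1 - s.kalmanGain k) * closedLoopProd k

/-- The effective gain for horizon length `N`. -/
def Keff (N : ℕ) : Matrix (Fin m) (Fin n ⊕ Fin m) ℝ :=
  s.GPrev 0 * s.innov 0
    + ∑ k ∈ Finset.Icc 1 N, s.GPrev k * s.Phiᵀ * s.innov k * s.closedLoopProd k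

/-- The reduction of the smoothed initial covariance brought by measurement `k`, that is
`G_{k-1} Φ_{k-1}ᵀ S_k Φ_{k-1} G_{k-1}ᵀ`. -/
def deltaP (k : ℕ) : Matrix (Fin m) (Fin m) ℝ :=
  s.GPrev k * (s.PhiPrev k)ᵀ * s.innov k * s.PhiPrev k * (s.GPrev k)ᵀ

/-- The smoothed initial-time covariance (of the control block, the only nonzero one) for horizon
length `N`. -/
def smoothedCov (N : ℕ) : Matrix (Fin m) (Fin m) ℝ :=
  sel n m * s.postCov 0 * (sel n m)ᵀ - ∑ k ∈ Finset.Icc 1 N, s.deltaP k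

/-- The termination metric `tr (ΔP) / tr P` at horizon length `N`. -/
def tau (N : ℕ) : ℝ :=
  (s.deltaP N).trace / (s.smoothedCov N).trace

/-- The closed-loop Kalman system `(1 - K) Φ`, as a complex matrix. -/
def closedLoop (K : Matrix (Fin n ⊕ Fin m) (Fin n ⊕ Fin m) ℝ) :
    Matrix (Fin n ⊕ Fin m) (Fin n ⊕ Fin m) ℂ :=
  ((1 - K) * s.Phi).map (fun t : ℝ => (t : ℂ))

/-- The largest magnitude of an eigenvalue of `(1 - K) Φ`. -/
def lamMax (K : Matrix (Fin n ⊕ Fin m) (Fin n ⊕ Fin m) ℝ) : ℝ :=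
  (spectralRadius ℂ (s.closedLoop K)).toReal

/-- The eigenvalues of `(1 - K) Φ` of largest magnitude are semisimple (their algebraic and
geometric multiplicities agree). -/
def DominantSemisimple (K : Matrix (Fin n ⊕ Fin m) (Fin n ⊕ Fin m) ℝ) : Prop :=
  ∀ c : ℂ, ‖c‖ = s.lamMax K → ∀ v : Fin n ⊕ Fin m → ℂ,
    ((s.closedLoop K - c • (1 : Matrix (Fin n ⊕ Fin m) (Fin n ⊕ Fin m) ℂ)) ^ 2) *ᵥ v = 0 →
    (s.closedLoop K - c • (1 : Matrix (Fin n ⊕ Fin m) (Fin n ⊕ Fin m) ℂ)) *ᵥ v = 0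

end

end LqrData

/-! The proof rests on the duality between filtering and control. Write R = W⁻¹, Q = EᵀR̃⁻¹E, T_N
for the closed-loop product started from prior Q, and V_j(Y) for the information gathered by j
measurements from prior Y. Differences of Riccati quantities factor exactly: the j-th iterates from
X and Y differ by T_j(X)(X − Y)T_j(Y)ᵀ, T_j(Y) = T_j(X)(1 + (X − Y)V_j(Y)), and V_j(Y) − V_j(X) =
V_j(X)(X − Y)V_j(Y). A filter started from 0 has transition Φ and prior Q after one step, so
V_{j+1}(0) = W + ΦᵀV_j(Q)Φ. Combined with the last identity this is the Bellman recursion, and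
V_j(Q) is the value matrix of the j-stage control problem. The effective gain, the smoothed
covariance and its decrease are linear images of V_{N+1}(Q) and of the increment T_NᵀS_N T_N.

Controllability bounds V_j(Q), by the cost of steering to 0, and hence V_j(Y) ≤ V_j(0) uniformly in
Y. The increments are then summable. As the matrices S_N⁻¹ are bounded, T_N → 0. Since V_{N+j} − V_N
= T_Nᵀ V_j(P_N) T_N, the value matrices converge to some Z with error O(‖T_N‖²), and Z gives the
unique gain R̃⁻¹EZ by completion of the square. The covariances P_N converge as well. The
factorization of T_j makes ‖T_N‖ comparable to the N-th power of the limiting closed loop, and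
Jordan theory for (1 − K)Φ gives the rates.

Conversely, controllability gives ‖T_N‖ ≤ c‖T_N Eᵀ‖, so tr ΔP_N is comparable to ‖T_N‖² and the gain
error to ‖T_{N+1}‖². Ranges of powers of the limiting closed loop stabilize, so consecutive norms
are comparable for large N. The limiting smoothed covariance is positive definite, which turns the
trace bounds into bounds on τ_N. -/

/-! ### Riccati recursion with full measurement -/

namespace Riccati

variable {ι : Type*} [Fintype ι] [DecidableEq ι]

/-- One-step transition matrix `Φ (1 - K)` of the Kalman filter with prior covariance `Y`. -/
noncomputable def closed (Φ R Y : Matrix ι ι ℝ) : Matrix ι ι ℝ := Φ * R * (Y + R)⁻¹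

/-- The Riccati map on prior covariances. -/
noncomputable def step (Φ R Q Y : Matrix ι ι ℝ) : Matrix ι ι ℝ :=
  Φ * (R - R * (Y + R)⁻¹ * R) * Φᵀ + Q

/-- Product of the first `j` transition matrices of the filter started from `Y`. -/
noncomputable def trans (Φ R Q : Matrix ι ι ℝ) : ℕ → Matrix ι ι ℝ → Matrix ι ι ℝ
  | 0, _ => 1
  | j + 1, Y => trans Φ R Q j (step Φ R Q Y) * closed Φ R Y

/-- Information matrix gathered by the first `j` measurements of the filter started from `Y`. -/
noncomputable def info (Φ R Q : Matrix ι ι ℝ) : ℕ → Matrix ι ι ℝ → Matrix ι ι ℝ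
  | 0, _ => 0
  | j + 1, Y => (Y + R)⁻¹ + (closed Φ R Y)ᵀ * info Φ R Q j (step Φ R Q Y) * closed Φ R Y

set_option linter.unusedSectionVars false

variable {Φ R Q X Y : Matrix ι ι ℝ}

lemma posSemidef_congr_transpose {κ : Type*} [Fintype κ] {M : Matrix ι ι ℝ} (hM : M.PosSemidef)
    (B : Matrix ι κ ℝ) : (Bᵀ * M * B).PosSemidef := by
  simpa [Matrix.conjTranspose_eq_transpose_of_trivial] using hM.conjTranspose_mul_mul_same B

lemma posSemidef_congr {κ : Type*} [Fintype κ] {M : Matrix ι ι ℝ} (hM : M.PosSemidef)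
    (B : Matrix κ ι ℝ) : (B * M * Bᵀ).PosSemidef := by
  simpa [Matrix.conjTranspose_eq_transpose_of_trivial] using hM.mul_mul_conjTranspose_same B

lemma _root_.Matrix.PosSemidef.transpose_eq {M : Matrix ι ι ℝ} (hM : M.PosSemidef) : Mᵀ = M := by
  simpa [Matrix.conjTranspose_eq_transpose_of_trivial] using hM.isHermitian.eq

lemma posDef_add (hR : R.PosDef) (hY : Y.PosSemidef) : (Y + R).PosDef := hR.posSemidef_add hY

lemma inv_mul_add (hR : R.PosDef) (hY : Y.PosSemidef) : (Y + R)⁻¹ * (Y + R) = 1 :=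
  Matrix.nonsing_inv_mul _ ((Matrix.isUnit_iff_isUnit_det _).1 (posDef_add hR hY).isUnit)

lemma add_mul_inv (hR : R.PosDef) (hY : Y.PosSemidef) : (Y + R) * (Y + R)⁻¹ = 1 :=
  Matrix.mul_nonsing_inv _ ((Matrix.isUnit_iff_isUnit_det _).1 (posDef_add hR hY).isUnit)

lemma transpose_inv_add (hR : R.PosDef) (hY : Y.PosSemidef) : ((Y + R)⁻¹)ᵀ = (Y + R)⁻¹ :=
  (posDef_add hR hY).inv.posSemidef.transpose_eq

lemma closed_transpose (hR : R.PosDef) (hY : Y.PosSemidef) :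
    (closed Φ R Y)ᵀ = (Y + R)⁻¹ * R * Φᵀ := by
  simp [closed, Matrix.transpose_mul, transpose_inv_add hR hY, hR.posSemidef.transpose_eq,
    Matrix.mul_assoc]

lemma inv_sub_inv (hR : R.PosDef) (hX : X.PosSemidef) (hY : Y.PosSemidef) :
    (Y + R)⁻¹ - (X + R)⁻¹ = (X + R)⁻¹ * (X - Y) * (Y + R)⁻¹ := by
  have h : X - Y = (X + R) - (Y + R) := by abel
  rw [h, Matrix.mul_sub, Matrix.sub_mul, inv_mul_add hR hX, Matrix.mul_assoc _ _ (Y + R)⁻¹,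
    add_mul_inv hR hY, Matrix.one_mul, Matrix.mul_one]

lemma closed_eq_mul (hR : R.PosDef) (hX : X.PosSemidef) (hY : Y.PosSemidef) :
    closed Φ R Y = closed Φ R X * (1 + (X - Y) * (Y + R)⁻¹) := by
  have h := inv_sub_inv hR hX hY
  have h' : (Y + R)⁻¹ = (X + R)⁻¹ + (X + R)⁻¹ * (X - Y) * (Y + R)⁻¹ := by
    rw [← h]; abel
  unfold closed
  conv_lhs => rw [h']
  noncomm_ring

lemma closed_mul_sub (hR : R.PosDef) (hX : X.PosSemidef) (hY : Y.PosSemidef) :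
    closed Φ R X * (X - Y) * (Y + R)⁻¹ = closed Φ R Y - closed Φ R X := by
  rw [closed_eq_mul hR hX hY]; noncomm_ring

lemma closed_zero (hR : R.PosDef) : closed Φ R 0 = Φ := by
  rw [closed, zero_add, Matrix.mul_assoc, Matrix.mul_nonsing_inv _
    ((Matrix.isUnit_iff_isUnit_det _).1 hR.isUnit), Matrix.mul_one]

lemma step_zero (hR : R.PosDef) : step Φ R Q 0 = Q := by
  rw [step, zero_add, Matrix.mul_nonsing_inv _ ((Matrix.isUnit_iff_isUnit_det _).1 hR.isUnit)]
  simp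

lemma step_posSemidef (hR : R.PosDef) (hQ : Q.PosSemidef) (hY : Y.PosSemidef) :
    (step Φ R Q Y).PosSemidef := by
  -- Joseph form of the posterior covariance, (1 − K)Y(1 − K)ᵀ + KRKᵀ with 1 − K = R(Y + R)⁻¹: both
  -- terms are visibly semidefinite.
  have h : R - R * (Y + R)⁻¹ * R = (R * (Y + R)⁻¹) * Y * (R * (Y + R)⁻¹)ᵀ
      + (1 - R * (Y + R)⁻¹) * R * (1 - R * (Y + R)⁻¹)ᵀ := by
    rw [Matrix.transpose_sub, Matrix.transpose_mul, transpose_inv_add hR hY,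
      hR.posSemidef.transpose_eq, Matrix.transpose_one]
    have e : R * (Y + R)⁻¹ * Y * ((Y + R)⁻¹ * R)
        = R * (Y + R)⁻¹ * ((Y + R) * (Y + R)⁻¹) * R - R * (Y + R)⁻¹ * R * ((Y + R)⁻¹ * R) := by
      noncomm_ring
    rw [e, add_mul_inv hR hY]
    noncomm_ring
  unfold step
  refine (posSemidef_congr ?_ Φ).add hQ
  rw [h]
  exact (posSemidef_congr hY _).add (posSemidef_congr hR.posSemidef _)

lemma iterate_step_posSemidef (hR : R.PosDef) (hQ : Q.PosSemidef) (hY : Y.PosSemidef) (j : ℕ) :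
    ((step Φ R Q)^[j] Y).PosSemidef := by
  induction j with
  | zero => exact hY
  | succ j ih => rw [Function.iterate_succ_apply']; exact step_posSemidef hR hQ ih

/-- The resolvent identity turns a difference of Riccati steps into an exact product, with no
remainder, so it can be iterated. -/
lemma step_sub_step (hR : R.PosDef) (hX : X.PosSemidef) (hY : Y.PosSemidef) :
    step Φ R Q X - step Φ R Q Y = closed Φ R X * (X - Y) * (closed Φ R Y)ᵀ := by
  have h := inv_sub_inv hR hX hY
  have e : step Φ R Q X - step Φ R Q Y = Φ * R * ((Y + R)⁻¹ - (X + R)⁻¹) * R * Φᵀ := by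
    unfold step; noncomm_ring
  rw [e, h, closed_transpose hR hY, closed]
  noncomm_ring

lemma trans_add (a b : ℕ) (Y : Matrix ι ι ℝ) :
    trans Φ R Q (a + b) Y = trans Φ R Q b ((step Φ R Q)^[a] Y) * trans Φ R Q a Y := by
  induction a generalizing Y with
  | zero => simp [trans]
  | succ a ih =>
    rw [Nat.add_right_comm, trans, ih, Function.iterate_succ_apply, trans,
      Matrix.mul_assoc]

lemma trans_succ (j : ℕ) (Y : Matrix ι ι ℝ) :
    trans Φ R Q (j + 1) Y = closed Φ R ((step Φ R Q)^[j] Y) * trans Φ R Q j Y := by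
  rw [trans_add]; simp [trans]

lemma info_add (a b : ℕ) (Y : Matrix ι ι ℝ) :
    info Φ R Q (a + b) Y = info Φ R Q a Y +
      (trans Φ R Q a Y)ᵀ * info Φ R Q b ((step Φ R Q)^[a] Y) * trans Φ R Q a Y := by
  induction a generalizing Y with
  | zero => simp [trans, info]
  | succ a ih =>
    rw [Nat.add_right_comm, info, ih, Function.iterate_succ_apply, trans,
      info, Matrix.transpose_mul]
    noncomm_ring

lemma info_succ (j : ℕ) (Y : Matrix ι ι ℝ) :
    info Φ R Q (j + 1) Y = info Φ R Q j Y +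
      (trans Φ R Q j Y)ᵀ * ((step Φ R Q)^[j] Y + R)⁻¹ * trans Φ R Q j Y := by
  rw [info_add]; simp [info]

lemma iterate_step_sub (hR : R.PosDef) (hQ : Q.PosSemidef) (hX : X.PosSemidef) (hY : Y.PosSemidef)
    (j : ℕ) :
    (step Φ R Q)^[j] X - (step Φ R Q)^[j] Y
      = trans Φ R Q j X * (X - Y) * (trans Φ R Q j Y)ᵀ := by
  induction j with
  | zero => simp [trans]
  | succ j ih =>
    rw [Function.iterate_succ_apply', Function.iterate_succ_apply', step_sub_step hR
      (iterate_step_posSemidef hR hQ hX j) (iterate_step_posSemidef hR hQ hY j), ih, trans_succ,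
      trans_succ, Matrix.transpose_mul]
    noncomm_ring

/-- Each step contributes the factor 1 + (difference of priors)(Y + R)⁻¹, and these accumulate into
the information matrix. Once the information is bounded, transition products from different priors
are comparable in norm. -/
lemma trans_eq_mul (hR : R.PosDef) (hQ : Q.PosSemidef) (hX : X.PosSemidef) (hY : Y.PosSemidef)
    (j : ℕ) :
    trans Φ R Q j Y = trans Φ R Q j X * (1 + (X - Y) * info Φ R Q j Y) := by
  induction j with
  | zero => simp [trans, info]
  | succ j ih =>
    have h := iterate_step_sub (Φ := Φ) hR hQ hX hY j
    rw [trans_succ, trans_succ, info_succ, closed_eq_mul hR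
      (iterate_step_posSemidef hR hQ hX j) (iterate_step_posSemidef hR hQ hY j), h]
    have e : ∀ L T S T' I V D D' : Matrix ι ι ℝ, T' = T * (I + D * V) →
        L * (I + T * D * D' * S) * T' = L * (I * T' + T * D * (D' * S * T')) := by
      intros; noncomm_ring
    rw [e _ _ _ _ 1 _ _ _ ih, Matrix.one_mul]
    conv_lhs => enter [2, 1]; rw [ih]
    noncomm_ring

lemma info_posSemidef (hR : R.PosDef) (hQ : Q.PosSemidef) (hY : Y.PosSemidef) (j : ℕ) :
    (info Φ R Q j Y).PosSemidef := by
  induction j with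
  | zero => exact Matrix.PosSemidef.zero
  | succ j ih =>
    rw [info_succ]
    exact ih.add (posSemidef_congr_transpose
      (posDef_add hR (iterate_step_posSemidef hR hQ hY j)).inv.posSemidef _)

/-- Prior uncertainty adds to the inverse of the information: formally V_j(Y) = (V_j(0)⁻¹ + Y)⁻¹,
and this is its resolvent identity, free of inverses of V_j. -/
lemma info_sub_info (hR : R.PosDef) (hQ : Q.PosSemidef) (hX : X.PosSemidef) (hY : Y.PosSemidef)
    (j : ℕ) :
    info Φ R Q j Y - info Φ R Q j X = info Φ R Q j X * (X - Y) * info Φ R Q j Y := by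
  induction j generalizing X Y with
  | zero => simp [info]
  | succ j ih =>
    have h1 := ih (step_posSemidef (Φ := Φ) hR hQ hX) (step_posSemidef (Φ := Φ) hR hQ hY)
    rw [step_sub_step hR hX hY] at h1
    have h2 := closed_mul_sub (Φ := Φ) hR hX hY
    have h3 := congrArg Matrix.transpose (closed_mul_sub (Φ := Φ) hR hY hX)
    rw [Matrix.transpose_mul, Matrix.transpose_mul, transpose_inv_add hR hX, Matrix.transpose_sub,
      Matrix.transpose_sub, hX.transpose_eq, hY.transpose_eq] at h3
    have h4 := inv_sub_inv hR hX hY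
    rw [info, info]
    set SX := (X + R)⁻¹
    set SY := (Y + R)⁻¹
    set LX := closed Φ R X
    set LY := closed Φ R Y
    set VX := info Φ R Q j (step Φ R Q X)
    set VY := info Φ R Q j (step Φ R Q Y)
    have e : (SX + LXᵀ * VX * LX) * (X - Y) * (SY + LYᵀ * VY * LY)
        = SX * (X - Y) * SY + LXᵀ * VX * (LX * (X - Y) * SY)
          - (SX * ((Y - X) * LYᵀ)) * VY * LY
          + LXᵀ * (VX * (LX * (X - Y) * LYᵀ) * VY) * LY := by
      noncomm_ring
    rw [e, ← h1, h2, h3, ← h4]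
    noncomm_ring

/-- Prior uncertainty only lowers the information matrix. -/
lemma info_le_info_zero (hR : R.PosDef) (hQ : Q.PosSemidef) (hY : Y.PosSemidef) (j : ℕ) :
    (info Φ R Q j 0 - info Φ R Q j Y).PosSemidef := by
  have h0 := Matrix.PosSemidef.zero (n := ι) (R := ℝ)
  have h := info_sub_info (Φ := Φ) hR hQ hY h0 j
  have hV := info_posSemidef (Φ := Φ) hR hQ hY j
  have hU := info_posSemidef (Φ := Φ) hR hQ h0 j
  rw [sub_zero] at h
  have ht := congrArg Matrix.transpose h
  rw [Matrix.transpose_mul, Matrix.transpose_mul, Matrix.transpose_sub, hV.transpose_eq,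
    hU.transpose_eq, hY.transpose_eq] at ht
  set U := info Φ R Q j 0
  set V := info Φ R Q j Y
  -- Substituting U = V + UYV into U − V = VYU gives VYV + (VY)U(YV), a sum of congruences.
  have e : U - V = V * Y * Vᵀ + (V * Y) * U * (V * Y)ᵀ := by
    rw [Matrix.transpose_mul, hV.transpose_eq, hY.transpose_eq]
    have : (V * Y) * U * (Y * V) = V * Y * (U * (Y * V)) := by noncomm_ring
    rw [this, ← ht, Matrix.mul_sub, ← h]
    abel
  rw [e]
  exact (posSemidef_congr hY V).add (posSemidef_congr hU _)

end Riccati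

/-! ### Norm estimates for matrices -/

namespace Matrix

set_option linter.unusedSectionVars false

variable {ι κ : Type*} [Fintype ι] [Fintype κ] [DecidableEq ι] [DecidableEq κ]

lemma l2_opNorm_transpose (A : Matrix ι κ ℝ) : ‖Aᵀ‖ = ‖A‖ := by
  rw [← conjTranspose_eq_transpose_of_trivial, l2_opNorm_conjTranspose]

lemma l2_opNorm_transpose_mul_self (A : Matrix ι κ ℝ) : ‖Aᵀ * A‖ = ‖A‖ * ‖A‖ := by
  rw [← conjTranspose_eq_transpose_of_trivial, l2_opNorm_conjTranspose_mul_self]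

lemma exists_l2_opNorm_le_of_entries (ι κ : Type*) [Fintype ι] [Fintype κ] [DecidableEq ι]
    [DecidableEq κ] :
    ∃ c : ℝ, 0 ≤ c ∧ ∀ (A : Matrix ι κ ℝ) (b : ℝ), (∀ i j, ‖A i j‖ ≤ b) → ‖A‖ ≤ c * b := by
  refine ⟨∑ i : ι, ∑ j : κ, ‖(single i j 1 : Matrix ι κ ℝ)‖, by positivity, fun A b h => ?_⟩
  conv_lhs => rw [matrix_eq_sum_single A]
  rw [Finset.sum_mul]
  refine (norm_sum_le _ _).trans (Finset.sum_le_sum fun i _ => ?_)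
  rw [Finset.sum_mul]
  refine (norm_sum_le _ _).trans (Finset.sum_le_sum fun j _ => ?_)
  have : (single i j (A i j) : Matrix ι κ ℝ) = A i j • single i j 1 := by simp [smul_single]
  rw [this, norm_smul, mul_comm]
  exact mul_le_mul_of_nonneg_left (h i j) (norm_nonneg _)

lemma exists_trace_le_l2_opNorm (ι : Type*) [Fintype ι] [DecidableEq ι] :
    ∃ c : ℝ, 0 < c ∧ ∀ A : Matrix ι ι ℝ, A.trace ≤ c * ‖A‖ := by
  let f := LinearMap.toContinuousLinearMap (traceLinearMap ι ℝ ℝ)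
  refine ⟨‖f‖ + 1, by positivity, fun A => ?_⟩
  have h : A.trace ≤ ‖f A‖ := le_abs_self _
  have h2 := f.le_opNorm A
  nlinarith [norm_nonneg A]

open scoped MatrixOrder in
lemma PosSemidef.exists_transpose_mul_self {M : Matrix ι ι ℝ} (hM : M.PosSemidef) :
    ∃ B : Matrix ι ι ℝ, M = Bᵀ * B := by
  obtain ⟨B, hB⟩ := CStarAlgebra.nonneg_iff_eq_star_mul_self.1 hM.nonneg
  exact ⟨B, by rw [hB, star_eq_conjTranspose, conjTranspose_eq_transpose_of_trivial]⟩

/-- With M = BᵀB the norm is ‖B‖², while the trace is the squared Frobenius norm of B. -/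
lemma PosSemidef.l2_opNorm_le_trace {M : Matrix ι ι ℝ} (hM : M.PosSemidef) : ‖M‖ ≤ M.trace := by
  obtain ⟨B, rfl⟩ := hM.exists_transpose_mul_self
  have ht : (Bᵀ * B).trace = ∑ i, ∑ j, B i j ^ 2 := by
    rw [Finset.sum_comm]
    simp [trace, mul_apply, sq]
  have h0 : 0 ≤ ∑ i, ∑ j, B i j ^ 2 := by positivity
  rw [l2_opNorm_transpose_mul_self, ht]
  have : ‖B‖ ≤ √(∑ i, ∑ j, B i j ^ 2) := by
    rw [l2_opNorm_def]
    refine ContinuousLinearMap.opNorm_le_bound _ (Real.sqrt_nonneg _) fun x => ?_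
    refine le_of_sq_le_sq ?_ (by positivity)
    rw [mul_pow, Real.sq_sqrt h0, EuclideanSpace.norm_sq_eq, EuclideanSpace.norm_sq_eq,
      Finset.sum_mul]
    refine Finset.sum_le_sum fun i _ => ?_
    have := Finset.sum_mul_sq_le_sq_mul_sq Finset.univ (fun j => B i j) (fun j => x j)
    simpa [mulVec, dotProduct] using this
  calc ‖B‖ * ‖B‖ ≤ √(∑ i, ∑ j, B i j ^ 2) * √(∑ i, ∑ j, B i j ^ 2) := by gcongr
    _ = _ := Real.mul_self_sqrt h0

lemma PosDef.inv_mul_self_eq_one {G : Matrix ι ι ℝ} (hG : G.PosDef) : G⁻¹ * G = 1 :=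
  nonsing_inv_mul _ ((isUnit_iff_isUnit_det _).1 hG.isUnit)

lemma PosDef.mul_inv_self_eq_one {G : Matrix ι ι ℝ} (hG : G.PosDef) : G * G⁻¹ = 1 :=
  mul_nonsing_inv _ ((isUnit_iff_isUnit_det _).1 hG.isUnit)

/-- For G = FᵀF, the matrix NᵀG⁻¹N is the Gram matrix of F⁻ᵀN, and N = Fᵀ(F⁻ᵀN). With G = P_k + R
this recovers the size of N from NᵀS_kN. -/
lemma PosDef.l2_opNorm_sq_le {G : Matrix ι ι ℝ} (hG : G.PosDef) (N : Matrix ι κ ℝ) :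
    ‖N‖ ^ 2 ≤ ‖G‖ * ‖Nᵀ * G⁻¹ * N‖ := by
  obtain ⟨F, hF⟩ := hG.posSemidef.exists_transpose_mul_self
  have hdet : IsUnit F.det := by
    have := (isUnit_iff_isUnit_det _).1 hG.isUnit
    rw [hF, det_mul] at this
    exact isUnit_of_mul_isUnit_right this
  have h1 : N = Fᵀ * ((F⁻¹)ᵀ * N) := by
    rw [← Matrix.mul_assoc, ← transpose_mul, nonsing_inv_mul _ hdet, transpose_one, Matrix.one_mul]
  have h2 : Nᵀ * G⁻¹ * N = ((F⁻¹)ᵀ * N)ᵀ * ((F⁻¹)ᵀ * N) := by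
    rw [hF, mul_inv_rev, transpose_mul, transpose_transpose, ← transpose_nonsing_inv]
    simp only [Matrix.mul_assoc]
  rw [h2, l2_opNorm_transpose_mul_self, hF, l2_opNorm_transpose_mul_self]
  have h3 : ‖N‖ ≤ ‖F‖ * ‖(F⁻¹)ᵀ * N‖ := by
    conv_lhs => rw [h1]
    exact (l2_opNorm_mul _ _).trans_eq (by rw [l2_opNorm_transpose])
  calc ‖N‖ ^ 2 ≤ (‖F‖ * ‖(F⁻¹)ᵀ * N‖) ^ 2 := by gcongr
    _ = _ := by ring

lemma PosSemidef.dotProduct_nonneg {M : Matrix ι ι ℝ} (hM : M.PosSemidef) (x : ι → ℝ) :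
    0 ≤ x ⬝ᵥ (M *ᵥ x) := by
  simpa using hM.dotProduct_mulVec_nonneg x

lemma PosDef.dotProduct_pos {M : Matrix ι ι ℝ} (hM : M.PosDef) {x : ι → ℝ} (hx : x ≠ 0) :
    0 < x ⬝ᵥ (M *ᵥ x) := by
  simpa using hM.dotProduct_mulVec_pos hx

lemma tendsto_dotProduct_mulVec {M : ℕ → Matrix ι ι ℝ} {L : Matrix ι ι ℝ}
    (h : Tendsto M atTop (𝓝 L)) (x : ι → ℝ) :
    Tendsto (fun j => x ⬝ᵥ (M j *ᵥ x)) atTop (𝓝 (x ⬝ᵥ (L *ᵥ x))) := by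
  have hc : Continuous fun A : Matrix ι ι ℝ => x ⬝ᵥ (A *ᵥ x) := by fun_prop
  exact (hc.tendsto L).comp h

lemma posSemidef_of_tendsto {M : ℕ → Matrix ι ι ℝ} {L : Matrix ι ι ℝ}
    (h : Tendsto M atTop (𝓝 L)) (hM : ∀ᶠ j in atTop, (M j).PosSemidef) : L.PosSemidef := by
  refine PosSemidef.of_dotProduct_mulVec_nonneg ?_ fun x => ?_
  · have hc : Continuous fun A : Matrix ι ι ℝ => Aᴴ := by fun_prop
    refine tendsto_nhds_unique ((hc.tendsto L).comp h) (h.congr' ?_)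
    filter_upwards [hM] with j hj using hj.isHermitian.eq.symm
  · refine ge_of_tendsto (tendsto_dotProduct_mulVec h x) ?_
    filter_upwards [hM] with j hj using hj.dotProduct_nonneg x

lemma tendsto_inv {M : ℕ → Matrix ι ι ℝ} {L : Matrix ι ι ℝ} (h : Tendsto M atTop (𝓝 L))
    (hL : L.det ≠ 0) : Tendsto (fun j => (M j)⁻¹) atTop (𝓝 L⁻¹) := by
  have hc : Continuous fun A : Matrix ι ι ℝ => A.adjugate := by fun_prop
  have hd : Continuous fun A : Matrix ι ι ℝ => A.det := by fun_prop
  simp only [inv_def, Ring.inverse_eq_inv']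
  exact (((hd.tendsto L).comp h).inv₀ hL).smul ((hc.tendsto L).comp h)

/-- Ranges of powers stabilize: eventually a power factors through the next one. -/
lemma exists_pow_eq_pow_succ_mul (A : Matrix ι ι ℝ) :
    ∃ (d : ℕ) (B : Matrix ι ι ℝ), A ^ d = A ^ (d + 1) * B := by
  obtain ⟨d, hd⟩ := Filter.eventually_atTop.1 (toLin' A).eventually_iInf_range_pow_eq
  have h : LinearMap.range (toLin' A ^ d) = LinearMap.range (toLin' A ^ (d + 1)) :=
    (hd d le_rfl).symm.trans (hd (d + 1) (Nat.le_succ d))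
  have h' : ∀ j : ι, ∃ y : ι → ℝ, A ^ (d + 1) *ᵥ y = (A ^ d) *ᵥ Pi.single j 1 := by
    intro j
    have : (toLin' A ^ d) (Pi.single j 1) ∈ LinearMap.range (toLin' A ^ (d + 1)) :=
      h ▸ LinearMap.mem_range_self _ _
    obtain ⟨y, hy⟩ := this
    exact ⟨y, by simpa only [← toLin'_pow, toLin'_apply] using hy⟩
  choose y hy using h'
  refine ⟨d, of fun i j => y j i, ?_⟩
  ext i j
  have := congrFun (hy j) i
  simp only [mulVec_single_one] at this
  rw [mul_apply]
  exact this.symm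

end Matrix

/-! ### Growth of matrix powers -/

namespace Matrix

variable {ι : Type*} [Fintype ι] [DecidableEq ι]

/-- Vectors whose orbit under `M` grows at most like `r ^ N`. -/
def growthSpace (M : Matrix ι ι ℂ) (r : ℝ) : Submodule ℂ (ι → ℂ) where
  carrier := {v | ∃ c : ℝ, ∀ N : ℕ, ‖M ^ N *ᵥ v‖ ≤ c * r ^ N}
  zero_mem' := ⟨0, by simp⟩
  add_mem' := by
    rintro v w ⟨c, hc⟩ ⟨d, hd⟩
    refine ⟨c + d, fun N => ?_⟩
    rw [mulVec_add, add_mul]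
    exact (norm_add_le _ _).trans (add_le_add (hc N) (hd N))
  smul_mem' := by
    rintro a v ⟨c, hc⟩
    refine ⟨‖a‖ * c, fun N => ?_⟩
    rw [mulVec_smul, norm_smul, mul_assoc]
    exact mul_le_mul_of_nonneg_left (hc N) (norm_nonneg _)

lemma pow_mulVec_eq_smul {M : Matrix ι ι ℂ} {μ : ℂ} {v : ι → ℂ} (h : M *ᵥ v = μ • v) (N : ℕ) :
    M ^ N *ᵥ v = μ ^ N • v := by
  induction N with
  | zero => simp
  | succ N ih => rw [pow_succ', ← mulVec_mulVec, ih, mulVec_smul, h, smul_smul, pow_succ]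

lemma mem_growthSpace_of_lt {M : Matrix ι ι ℂ} {r : ℝ} {μ : ℂ} (hμ : ‖μ‖ < r) (k : ℕ)
    (v : ι → ℂ) (hv : (M - μ • 1) ^ k *ᵥ v = 0) : v ∈ growthSpace M r := by
  have hr : 0 < r := (norm_nonneg _).trans_lt hμ
  induction k generalizing v with
  | zero =>
    have : v = 0 := by simpa using hv
    rw [this]; exact zero_mem _
  | succ k ih =>
    obtain ⟨c, hc⟩ := ih ((M - μ • 1) *ᵥ v) (by rw [mulVec_mulVec, ← pow_succ]; exact hv)
    have hc0 : 0 ≤ c := by simpa using (norm_nonneg _).trans (hc 0)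
    -- The orbit norms satisfy a_{N+1} ≤ ‖μ‖a_N + c r^N, and C r^N dominates them as soon as a_0 ≤ C
    -- and c ≤ C(r − ‖μ‖).
    refine ⟨max ‖v‖ (c / (r - ‖μ‖)), fun N => ?_⟩
    set C := max ‖v‖ (c / (r - ‖μ‖))
    have hC : c ≤ C * (r - ‖μ‖) := (div_le_iff₀ (sub_pos.2 hμ)).1 (le_max_right _ _)
    induction N with
    | zero => simp [C]
    | succ N ihN =>
      have e : M ^ (N + 1) *ᵥ v = μ • (M ^ N *ᵥ v) + M ^ N *ᵥ ((M - μ • 1) *ᵥ v) := by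
        rw [sub_mulVec, mulVec_sub, pow_succ, ← mulVec_mulVec, smul_mulVec, one_mulVec,
          mulVec_smul]
        abel
      rw [e]
      refine (norm_add_le _ _).trans ?_
      rw [norm_smul]
      have h1 := mul_le_mul_of_nonneg_left ihN (norm_nonneg μ)
      have h2 := hc N
      have h3 : c * r ^ N ≤ C * (r - ‖μ‖) * r ^ N := by gcongr
      calc _ ≤ ‖μ‖ * (C * r ^ N) + C * (r - ‖μ‖) * r ^ N := add_le_add h1 (h2.trans h3)
        _ = C * r ^ (N + 1) := by ring

lemma mulVec_eq_zero_of_pow_of_semisimple {B : Matrix ι ι ℂ}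
    (hs : ∀ w : ι → ℂ, B ^ 2 *ᵥ w = 0 → B *ᵥ w = 0) (k : ℕ) (v : ι → ℂ)
    (hv : B ^ (k + 1) *ᵥ v = 0) : B *ᵥ v = 0 := by
  induction k with
  | zero => simpa using hv
  | succ k ih =>
    apply ih
    rw [pow_succ', ← mulVec_mulVec]
    apply hs
    rwa [mulVec_mulVec, ← pow_add, add_comm 2 k]

/-- If every eigenvalue has magnitude less than `r`, or magnitude `r` and is semisimple, the powers
of `M` are `O(r ^ N)`. -/
lemma exists_entry_pow_le {M : Matrix ι ι ℂ} {r : ℝ} (hr : 0 ≤ r)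
    (h : ∀ (μ : ℂ) (v : ι → ℂ), v ≠ 0 → M *ᵥ v = μ • v → ‖μ‖ < r ∨ (‖μ‖ = r ∧
      ∀ w : ι → ℂ, (M - μ • 1) ^ 2 *ᵥ w = 0 → (M - μ • 1) *ᵥ w = 0)) :
    ∃ c : ℝ, ∀ N i j, ‖(M ^ N) i j‖ ≤ c * r ^ N := by
  -- Vectors of the required growth form a subspace, so it suffices to treat generalized
  -- eigenvectors, which span over ℂ.
  have htop : growthSpace M r = ⊤ := by
    rw [eq_top_iff, ← Module.End.iSup_maxGenEigenspace_eq_top (toLin' M), iSup_le_iff]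
    intro μ v hv
    obtain ⟨k, hk⟩ := (Module.End.mem_maxGenEigenspace _ _ _).1 hv
    have hk' : (M - μ • 1) ^ k *ᵥ v = 0 := by
      rw [← hk, ← toLin'_apply, toLin'_pow, map_sub, map_smul, toLin'_one]
      rfl
    by_cases hev : ∃ w : ι → ℂ, w ≠ 0 ∧ M *ᵥ w = μ • w
    · obtain ⟨w, hw0, hw⟩ := hev
      rcases h μ w hw0 hw with hlt | ⟨heq, hs⟩
      · exact mem_growthSpace_of_lt hlt k v hk'
      · have hv0 : (M - μ • 1) *ᵥ v = 0 := by
          refine mulVec_eq_zero_of_pow_of_semisimple hs k v ?_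
          rw [pow_succ', ← mulVec_mulVec, hk', mulVec_zero]
        have hv1 : M *ᵥ v = μ • v := by
          rwa [sub_mulVec, smul_mulVec, one_mulVec, sub_eq_zero] at hv0
        refine ⟨‖v‖, fun N => ?_⟩
        rw [pow_mulVec_eq_smul hv1, norm_smul, norm_pow, heq, mul_comm]
    · have hinj : ∀ (k : ℕ) (w : ι → ℂ), (M - μ • 1) ^ k *ᵥ w = 0 → w = 0 := by
        intro k
        induction k with
        | zero => intro w hw; simpa using hw
        | succ k ih =>
          intro w hw
          rw [pow_succ, ← mulVec_mulVec] at hw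
          have hw' := ih _ hw
          rw [sub_mulVec, smul_mulVec, one_mulVec, sub_eq_zero] at hw'
          by_contra hne
          exact hev ⟨w, hne, hw'⟩
      rw [hinj k v hk']
      exact zero_mem _
  have hmem : ∀ j : ι, ∃ c : ℝ, ∀ N : ℕ, ‖M ^ N *ᵥ Pi.single j 1‖ ≤ c * r ^ N := fun j => by
    have : (Pi.single j 1 : ι → ℂ) ∈ growthSpace M r := htop ▸ Submodule.mem_top
    exact this
  choose c hc using hmem
  have hc0 : ∀ j, 0 ≤ c j := fun j => by simpa using (norm_nonneg _).trans (hc j 0)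
  refine ⟨∑ j, c j, fun N i j => ?_⟩
  have h1 : ‖(M ^ N) i j‖ ≤ ‖M ^ N *ᵥ Pi.single j 1‖ := by
    have := norm_le_pi_norm (M ^ N *ᵥ Pi.single j 1) i
    simpa [mulVec_single_one] using this
  refine h1.trans ((hc j N).trans ?_)
  exact mul_le_mul_of_nonneg_right
    (Finset.single_le_sum (fun j _ => hc0 j) (Finset.mem_univ j)) (pow_nonneg hr N)

/-! ### Spectral radius through eigenvectors -/

lemma mem_spectrum_iff_exists {M : Matrix ι ι ℂ} {μ : ℂ} :
    μ ∈ spectrum ℂ M ↔ ∃ v : ι → ℂ, v ≠ 0 ∧ M *ᵥ v = μ • v := by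
  rw [← spectrum_toLin', ← Module.End.hasEigenvalue_iff_mem_spectrum]
  constructor
  · intro h
    obtain ⟨v, hv⟩ := h.exists_hasEigenvector
    exact ⟨v, hv.2, by simpa using hv.apply_eq_smul⟩
  · rintro ⟨v, hv0, hv⟩
    exact Module.End.hasEigenvalue_of_hasEigenvector
      (Module.End.hasEigenvector_iff.2 ⟨Module.End.mem_eigenspace_iff.2 (by simpa using hv), hv0⟩)

lemma norm_le_spectralRadius_toReal {M : Matrix ι ι ℂ} {μ : ℂ} (hμ : μ ∈ spectrum ℂ M) :
    ‖μ‖ ≤ (spectralRadius ℂ M).toReal := by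
  have hfin : spectralRadius ℂ M ≠ ⊤ := by
    rcases isEmpty_or_nonempty ι with hι | hι
    · rw [spectrum.SpectralRadius.of_subsingleton]; exact ENNReal.zero_ne_top
    · exact ne_top_of_le_ne_top ENNReal.coe_ne_top (spectrum.spectralRadius_le_nnnorm M)
  have h : (‖μ‖₊ : ℝ≥0∞) ≤ spectralRadius ℂ M :=
    le_iSup₂ (f := fun k (_ : k ∈ spectrum ℂ M) => (‖k‖₊ : ℝ≥0∞)) μ hμ
  simpa using ENNReal.toReal_mono hfin h

lemma exists_norm_eq_spectralRadius_toReal [Nonempty ι] (M : Matrix ι ι ℂ) :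
    ∃ (μ : ℂ) (v : ι → ℂ), v ≠ 0 ∧ M *ᵥ v = μ • v ∧ ‖μ‖ = (spectralRadius ℂ M).toReal := by
  obtain ⟨μ, hμ, h⟩ := spectrum.exists_nnnorm_eq_spectralRadius M
  obtain ⟨v, hv0, hv⟩ := mem_spectrum_iff_exists.1 hμ
  exact ⟨μ, v, hv0, hv, by rw [← h]; simp⟩

lemma spectralRadius_lt_one_of_tendsto {M : Matrix ι ι ℂ}
    (h : Tendsto (fun N : ℕ => M ^ N) atTop (𝓝 0)) : (spectralRadius ℂ M).toReal < 1 := by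
  rcases isEmpty_or_nonempty ι with hι | hι
  · rw [spectrum.SpectralRadius.of_subsingleton]; simp
  obtain ⟨μ, v, hv0, hv, hμ⟩ := exists_norm_eq_spectralRadius_toReal M
  rw [← hμ]
  have hc : Continuous fun A : Matrix ι ι ℂ => ‖A *ᵥ v‖ := by fun_prop
  have h1 := (hc.tendsto 0).comp h
  simp only [zero_mulVec, norm_zero, Function.comp_def, pow_mulVec_eq_smul hv, norm_smul,
    norm_pow] at h1
  by_contra! hle
  have h2 : ∀ N : ℕ, ‖v‖ ≤ ‖μ‖ ^ N * ‖v‖ := fun N =>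
    le_mul_of_one_le_left (norm_nonneg _) (one_le_pow₀ hle)
  exact hv0 (norm_le_zero_iff.1 (ge_of_tendsto' h1 h2))

lemma spectralRadius_eq_zero_of_pow_eq_zero {M : Matrix ι ι ℂ} {N : ℕ} (h : M ^ N = 0) :
    (spectralRadius ℂ M).toReal = 0 := by
  rcases isEmpty_or_nonempty ι with hι | hι
  · rw [spectrum.SpectralRadius.of_subsingleton]; simp
  obtain ⟨μ, v, hv0, hv, hμ⟩ := exists_norm_eq_spectralRadius_toReal M
  have h1 := pow_mulVec_eq_smul hv N
  rw [h, zero_mulVec, eq_comm, smul_eq_zero, or_iff_left hv0] at h1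
  rw [← hμ, eq_zero_of_pow_eq_zero h1, norm_zero]

end Matrix

namespace LqrData

open Riccati

variable {n m : ℕ} (s : LqrData n m)

/-! ### The filter quantities through the Riccati recursion -/

lemma sel_mul_transpose : sel n m * (sel n m)ᵀ = 1 := by
  simp [sel, Matrix.transpose_fromCols, Matrix.fromCols_mul_fromRows]

lemma sel_mulVec (x : Fin n ⊕ Fin m → ℝ) : sel n m *ᵥ x = fun i => x (Sum.inr i) := by
  ext i
  simp [sel, Matrix.fromCols_mulVec]

lemma sel_transpose_mulVec (v : Fin m → ℝ) : (sel n m)ᵀ *ᵥ v = Sum.elim (0 : Fin n → ℝ) v := by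
  simp [sel, Matrix.transpose_fromCols, Matrix.fromRows_mulVec]

lemma procCov_eq : s.procCov = (sel n m)ᵀ * s.Rt⁻¹ * sel n m := by
  ext (i | i) (j | j) <;>
    simp [procCov, sel, Matrix.transpose_fromCols, Matrix.fromRows_mul, Matrix.mul_fromCols]

/-- Information gathered by the first `k` measurements of the filter. -/
noncomputable def valueMat (k : ℕ) : Matrix (Fin n ⊕ Fin m) (Fin n ⊕ Fin m) ℝ :=
  info s.Phi s.measCov s.procCov k s.procCov

variable {s}

lemma procCov_posSemidef (hRt : s.Rt.PosDef) : s.procCov.PosSemidef := by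
  rw [procCov_eq]
  exact posSemidef_congr_transpose hRt.inv.posSemidef _

lemma measCov_posDef (hW : s.weight.PosDef) : s.measCov.PosDef := hW.inv

lemma measCov_inv (hW : s.weight.PosDef) : s.measCov⁻¹ = s.weight :=
  Matrix.nonsing_inv_nonsing_inv _ ((Matrix.isUnit_iff_isUnit_det _).1 hW.isUnit)

lemma sel_mul_procCov : sel n m * s.procCov = s.Rt⁻¹ * sel n m := by
  rw [procCov_eq, ← Matrix.mul_assoc, ← Matrix.mul_assoc, sel_mul_transpose, Matrix.one_mul]

lemma one_sub_gain {R P : Matrix (Fin n ⊕ Fin m) (Fin n ⊕ Fin m) ℝ} (hR : R.PosDef)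
    (hP : P.PosSemidef) : 1 - P * (P + R)⁻¹ = R * (P + R)⁻¹ := by
  rw [← add_mul_inv hR hP]; noncomm_ring

lemma priorCov_eq (hW : s.weight.PosDef) (hRt : s.Rt.PosDef) (k : ℕ) :
    s.priorCov k = (step s.Phi s.measCov s.procCov)^[k] s.procCov := by
  induction k with
  | zero => rfl
  | succ k ih =>
    have hR := measCov_posDef hW
    have hP : (s.priorCov k).PosSemidef := by
      rw [ih]; exact iterate_step_posSemidef hR (procCov_posSemidef hRt) (procCov_posSemidef hRt) k
    rw [Function.iterate_succ_apply', ← ih, priorCov, step, one_sub_gain hR hP]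
    have : s.measCov * (s.priorCov k + s.measCov)⁻¹ * s.priorCov k
        = s.measCov - s.measCov * (s.priorCov k + s.measCov)⁻¹ * s.measCov := by
      have h : s.priorCov k = (s.priorCov k + s.measCov) - s.measCov := by abel
      conv_lhs => rw [h]
      rw [Matrix.mul_sub, ← h, Matrix.mul_assoc _ _ (s.priorCov k + s.measCov),
        inv_mul_add hR hP, Matrix.mul_one]
    rw [this]

lemma priorCov_posSemidef (hW : s.weight.PosDef) (hRt : s.Rt.PosDef) (k : ℕ) :
    (s.priorCov k).PosSemidef := by
  rw [priorCov_eq hW hRt]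
  exact iterate_step_posSemidef (measCov_posDef hW) (procCov_posSemidef hRt)
    (procCov_posSemidef hRt) k

lemma closed_priorCov (hW : s.weight.PosDef) (hRt : s.Rt.PosDef) (k : ℕ) :
    s.Phi * (1 - s.kalmanGain k) = closed s.Phi s.measCov (s.priorCov k) := by
  rw [kalmanGain, innov, one_sub_gain (measCov_posDef hW) (priorCov_posSemidef hW hRt k), closed,
    Matrix.mul_assoc]

lemma closedLoopProd_eq (hW : s.weight.PosDef) (hRt : s.Rt.PosDef) (k : ℕ) :
    s.closedLoopProd k = trans s.Phi s.measCov s.procCov k s.procCov := by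
  induction k with
  | zero => rfl
  | succ k ih => rw [closedLoopProd, closed_priorCov hW hRt, ih, trans_succ, ← priorCov_eq hW hRt]

lemma valueMat_succ (hW : s.weight.PosDef) (hRt : s.Rt.PosDef) (k : ℕ) :
    s.valueMat (k + 1) = s.valueMat k + (s.closedLoopProd k)ᵀ * s.innov k * s.closedLoopProd k := by
  rw [valueMat, info_succ, ← priorCov_eq hW hRt, ← closedLoopProd_eq hW hRt]; rfl

lemma valueMat_posSemidef (hW : s.weight.PosDef) (hRt : s.Rt.PosDef) (k : ℕ) :
    (s.valueMat k).PosSemidef :=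
  info_posSemidef (measCov_posDef hW) (procCov_posSemidef hRt) (procCov_posSemidef hRt) k

lemma GPrev_mul_PhiPrev_transpose (k : ℕ) :
    s.GPrev k * (s.PhiPrev k)ᵀ = s.Rt⁻¹ * sel n m * (s.closedLoopProd k)ᵀ := by
  induction k with
  | zero => simp [GPrev, PhiPrev, closedLoopProd, priorCov, sel_mul_procCov]
  | succ k ih =>
    rw [GPrev, ih, PhiPrev, closedLoopProd, Matrix.transpose_mul, Matrix.transpose_mul]
    simp only [Matrix.mul_assoc]

lemma deltaP_eq (hRt : s.Rt.PosDef) (k : ℕ) :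
    s.deltaP k = s.Rt⁻¹ * sel n m * ((s.closedLoopProd k)ᵀ * s.innov k * s.closedLoopProd k)
      * (sel n m)ᵀ * s.Rt⁻¹ := by
  have h := congrArg Matrix.transpose (GPrev_mul_PhiPrev_transpose (s := s) k)
  simp only [Matrix.transpose_mul, Matrix.transpose_transpose] at h
  rw [hRt.inv.posSemidef.transpose_eq] at h
  rw [deltaP, GPrev_mul_PhiPrev_transpose, Matrix.mul_assoc _ (s.PhiPrev k), h]
  simp only [Matrix.mul_assoc]

/-- Horizon N uses the N + 1 measurements 0, …, N, whence the shift. The effective gain is the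
optimal first gain of the (N + 1)-stage control problem. -/
lemma Keff_eq (hW : s.weight.PosDef) (hRt : s.Rt.PosDef) (N : ℕ) :
    s.Keff N = s.Rt⁻¹ * sel n m * s.valueMat (N + 1) := by
  induction N with
  | zero =>
    rw [valueMat_succ hW hRt]
    simp [Keff, GPrev, closedLoopProd, priorCov, sel_mul_procCov, valueMat, info]
  | succ N ih =>
    have e : s.Keff (N + 1) = s.Keff N
        + s.GPrev (N + 1) * (s.PhiPrev (N + 1))ᵀ * s.innov (N + 1) * s.closedLoopProd (N + 1) := by
      rw [Keff, Keff, Finset.sum_Icc_succ_top (by omega), ← add_assoc]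
      rfl
    rw [e, ih, valueMat_succ hW hRt (N + 1), GPrev_mul_PhiPrev_transpose]
    simp only [Matrix.mul_add, Matrix.mul_assoc]

lemma smoothedCov_eq (hW : s.weight.PosDef) (hRt : s.Rt.PosDef) (N : ℕ) :
    s.smoothedCov N
      = s.Rt⁻¹ - s.Rt⁻¹ * sel n m * s.valueMat (N + 1) * (sel n m)ᵀ * s.Rt⁻¹ := by
  induction N with
  | zero =>
    have h : s.procCov * (sel n m)ᵀ = (sel n m)ᵀ * s.Rt⁻¹ := by
      rw [procCov_eq, Matrix.mul_assoc, sel_mul_transpose, Matrix.mul_one]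
    rw [valueMat_succ hW hRt]
    simp only [smoothedCov, postCov, kalmanGain, closedLoopProd, priorCov, valueMat, info]
    have e : sel n m * ((1 - s.procCov * s.innov 0) * s.procCov) * (sel n m)ᵀ
        = (sel n m * s.procCov) * (sel n m)ᵀ
          - (sel n m * s.procCov) * s.innov 0 * (s.procCov * (sel n m)ᵀ) := by
      simp only [Matrix.mul_sub, Matrix.sub_mul, Matrix.mul_assoc, Matrix.one_mul]
    rw [e, h, sel_mul_procCov, Matrix.mul_assoc _ (sel n m) (sel n m)ᵀ, sel_mul_transpose]
    simp [Matrix.mul_assoc]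
  | succ N ih =>
    have e : s.smoothedCov (N + 1) = s.smoothedCov N - s.deltaP (N + 1) := by
      rw [smoothedCov, smoothedCov, Finset.sum_Icc_succ_top (by omega)]
      abel
    rw [e, ih, valueMat_succ hW hRt (N + 1), deltaP_eq hRt]
    simp only [Matrix.mul_add, Matrix.add_mul]
    abel

/-! ### Bellman equation -/

variable (s) in
/-- `Z` is the optimal cost-to-go matrix when the cost-to-go after one step is `Z'`. -/
structure IsBellmanStep (Z' Z : Matrix (Fin n ⊕ Fin m) (Fin n ⊕ Fin m) ℝ) : Prop where
  posSemidef_left : Z'.PosSemidef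
  posSemidef_right : Z.PosSemidef
  eq : (s.weight + s.Phiᵀ * Z' * s.Phi) - Z = Z * s.procCov * (s.weight + s.Phiᵀ * Z' * s.Phi)

lemma info_zero_succ (hW : s.weight.PosDef) (k : ℕ) :
    info s.Phi s.measCov s.procCov (k + 1) 0
      = s.weight + s.Phiᵀ * s.valueMat k * s.Phi := by
  rw [info, closed_zero (measCov_posDef hW), step_zero (measCov_posDef hW), zero_add,
    measCov_inv hW, valueMat]

/-- Minimizing over the control increment replaces U by (U⁻¹ + Q)⁻¹, which is how information
changes when the prior passes from 0 to Q. -/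
lemma isBellmanStep_valueMat (hW : s.weight.PosDef) (hRt : s.Rt.PosDef) (k : ℕ) :
    s.IsBellmanStep (s.valueMat k) (s.valueMat (k + 1)) where
  posSemidef_left := valueMat_posSemidef hW hRt k
  posSemidef_right := valueMat_posSemidef hW hRt (k + 1)
  eq := by
    have h := info_sub_info (Φ := s.Phi) (measCov_posDef hW) (procCov_posSemidef hRt)
      (procCov_posSemidef hRt) Matrix.PosSemidef.zero (k + 1)
    rwa [info_zero_succ hW, sub_zero] at h

lemma dotProduct_mulVec_eq {ι κ : Type*} [Fintype ι] [Fintype κ] (M : Matrix ι κ ℝ) (x : ι → ℝ)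
    (y : κ → ℝ) : x ⬝ᵥ (M *ᵥ y) = (Mᵀ *ᵥ x) ⬝ᵥ y := by
  rw [Matrix.dotProduct_mulVec, Matrix.mulVec_transpose]

/-- Completion of the square in the Bellman equation. -/
lemma IsBellmanStep.completed_square (hW : s.weight.PosDef) (hRt : s.Rt.PosDef)
    {Z' Z : Matrix (Fin n ⊕ Fin m) (Fin n ⊕ Fin m) ℝ} (h : s.IsBellmanStep Z' Z) :
    ∃ G : Matrix (Fin m) (Fin m) ℝ, G.PosDef ∧ ∀ (χ : Fin n ⊕ Fin m → ℝ) (v : Fin m → ℝ),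
      (χ + (sel n m)ᵀ *ᵥ v) ⬝ᵥ (s.weight *ᵥ (χ + (sel n m)ᵀ *ᵥ v)) + v ⬝ᵥ (s.Rt *ᵥ v)
        + (s.Phi *ᵥ (χ + (sel n m)ᵀ *ᵥ v)) ⬝ᵥ (Z' *ᵥ (s.Phi *ᵥ (χ + (sel n m)ᵀ *ᵥ v)))
      = χ ⬝ᵥ (Z *ᵥ χ) + (v + (s.Rt⁻¹ * sel n m * Z) *ᵥ χ) ⬝ᵥ
          (G *ᵥ (v + (s.Rt⁻¹ * sel n m * Z) *ᵥ χ)) := by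
  have heq := h.eq
  have hUp : (s.weight + s.Phiᵀ * Z' * s.Phi).PosSemidef :=
    hW.posSemidef.add (posSemidef_congr_transpose h.posSemidef_left _)
  have hU : ∀ y : Fin n ⊕ Fin m → ℝ, y ⬝ᵥ (s.weight *ᵥ y) + (s.Phi *ᵥ y) ⬝ᵥ (Z' *ᵥ (s.Phi *ᵥ y))
      = y ⬝ᵥ ((s.weight + s.Phiᵀ * Z' * s.Phi) *ᵥ y) := by
    intro y
    rw [Matrix.add_mulVec, dotProduct_add, ← Matrix.mulVec_mulVec, ← Matrix.mulVec_mulVec,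
      dotProduct_mulVec_eq s.Phiᵀ, Matrix.transpose_transpose]
  set U := s.weight + s.Phiᵀ * Z' * s.Phi with hUdef
  set E := sel n m
  set K := s.Rt⁻¹ * E * Z with hK
  have hUt := hUp.transpose_eq
  have hZt := h.posSemidef_right.transpose_eq
  have hRit := hRt.inv.posSemidef.transpose_eq
  have hQt := (procCov_posSemidef hRt).transpose_eq
  have heqT : U - Z = U * s.procCov * Z := by
    have := congrArg Matrix.transpose heq
    rwa [Matrix.transpose_sub, Matrix.transpose_mul, Matrix.transpose_mul, hUt, hZt, hQt,
      ← Matrix.mul_assoc] at this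
  have hG : (s.Rt + E * U * Eᵀ).PosDef := hRt.add_posSemidef (posSemidef_congr hUp E)
  set G := s.Rt + E * U * Eᵀ with hGdef
  -- Stationarity in v: G is the Hessian, and −Kχ is the minimizing increment.
  have ha : G * K = E * U := by
    have e : G * K = s.Rt * s.Rt⁻¹ * (E * Z) + E * (U * (Eᵀ * s.Rt⁻¹ * E) * Z) := by
      simp only [hGdef, hK, Matrix.add_mul, Matrix.mul_assoc]
    rw [e, hRt.mul_inv_self_eq_one, Matrix.one_mul, ← procCov_eq, ← heqT, Matrix.mul_sub]
    abel
  have hb : Kᵀ * (E * U) = U - Z := by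
    rw [heq, procCov_eq, hK, Matrix.transpose_mul, Matrix.transpose_mul, hZt, hRit]
    simp only [Matrix.mul_assoc, E]
  refine ⟨G, hG, fun χ v => ?_⟩
  have c1 : (K *ᵥ χ) ⬝ᵥ (G *ᵥ v) = v ⬝ᵥ (E *ᵥ (U *ᵥ χ)) := by
    rw [dotProduct_mulVec_eq, hG.posSemidef.transpose_eq, Matrix.mulVec_mulVec, ha, dotProduct_comm,
      Matrix.mulVec_mulVec]
  have c2 : (K *ᵥ χ) ⬝ᵥ (G *ᵥ (K *ᵥ χ)) = χ ⬝ᵥ (U *ᵥ χ) - χ ⬝ᵥ (Z *ᵥ χ) := by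
    have := dotProduct_mulVec_eq Kᵀ χ ((E * U) *ᵥ χ)
    rw [Matrix.transpose_transpose] at this
    rw [Matrix.mulVec_mulVec, ha, ← this, Matrix.mulVec_mulVec, hb, Matrix.sub_mulVec,
      dotProduct_sub]
  have c3 : v ⬝ᵥ (G *ᵥ (K *ᵥ χ)) = v ⬝ᵥ (E *ᵥ (U *ᵥ χ)) := by
    rw [Matrix.mulVec_mulVec, ha, Matrix.mulVec_mulVec]
  have c4 : v ⬝ᵥ (G *ᵥ v) = v ⬝ᵥ (s.Rt *ᵥ v) + (Eᵀ *ᵥ v) ⬝ᵥ (U *ᵥ (Eᵀ *ᵥ v)) := by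
    rw [hGdef, Matrix.add_mulVec, dotProduct_add, ← Matrix.mulVec_mulVec, ← Matrix.mulVec_mulVec,
      dotProduct_mulVec_eq E]
  have c5 : (Eᵀ *ᵥ v) ⬝ᵥ (U *ᵥ χ) = v ⬝ᵥ (E *ᵥ (U *ᵥ χ)) := by
    rw [dotProduct_mulVec_eq E]
  have c6 : χ ⬝ᵥ (U *ᵥ (Eᵀ *ᵥ v)) = v ⬝ᵥ (E *ᵥ (U *ᵥ χ)) := by
    rw [dotProduct_mulVec_eq U, hUt, dotProduct_comm, c5]
  have hU' := hU (χ + Eᵀ *ᵥ v)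
  have hexp : (χ + Eᵀ *ᵥ v) ⬝ᵥ (U *ᵥ (χ + Eᵀ *ᵥ v))
      = χ ⬝ᵥ (U *ᵥ χ) + 2 * (v ⬝ᵥ (E *ᵥ (U *ᵥ χ))) + (Eᵀ *ᵥ v) ⬝ᵥ (U *ᵥ (Eᵀ *ᵥ v)) := by
    rw [Matrix.mulVec_add, add_dotProduct, dotProduct_add, dotProduct_add, c5, c6]
    ring
  have hexp2 : (v + K *ᵥ χ) ⬝ᵥ (G *ᵥ (v + K *ᵥ χ))
      = v ⬝ᵥ (G *ᵥ v) + 2 * (v ⬝ᵥ (E *ᵥ (U *ᵥ χ))) + (χ ⬝ᵥ (U *ᵥ χ) - χ ⬝ᵥ (Z *ᵥ χ)) := by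
    rw [Matrix.mulVec_add, add_dotProduct, dotProduct_add, dotProduct_add, c1, c2, c3]
    ring
  rw [hexp2, c4]
  linarith [hU', hexp]

/-! ### Optimality -/

variable (s) in
/-- The augmented state `(x k, u (k-1))`. -/
def augState (x0 : Fin n → ℝ) (uLast : Fin m → ℝ) (u : ℕ → Fin m → ℝ) (k : ℕ) :
    Fin n ⊕ Fin m → ℝ :=
  Sum.elim (s.traj x0 u k) (prevControl uLast u k)

lemma augState_add (x0 : Fin n → ℝ) (uLast : Fin m → ℝ) (u : ℕ → Fin m → ℝ) (k : ℕ) :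
    s.augState x0 uLast u k + (sel n m)ᵀ *ᵥ (u k - prevControl uLast u k)
      = Sum.elim (s.traj x0 u k) (u k) := by
  rw [sel_transpose_mulVec, augState]
  ext (i | i) <;> simp

lemma augState_succ (x0 : Fin n → ℝ) (uLast : Fin m → ℝ) (u : ℕ → Fin m → ℝ) (k : ℕ) :
    s.augState x0 uLast u (k + 1)
      = s.Phi *ᵥ (s.augState x0 uLast u k + (sel n m)ᵀ *ᵥ (u k - prevControl uLast u k)) := by
  rw [augState_add, augState, Phi, Matrix.fromBlocks_mulVec]
  simp [traj, prevControl, Function.comp_def]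

lemma stageCost_eq (x0 : Fin n → ℝ) (uLast : Fin m → ℝ) (u : ℕ → Fin m → ℝ) (k : ℕ) :
    s.stageCost x0 uLast u k
      = (s.augState x0 uLast u k + (sel n m)ᵀ *ᵥ (u k - prevControl uLast u k)) ⬝ᵥ
          (s.weight *ᵥ (s.augState x0 uLast u k + (sel n m)ᵀ *ᵥ (u k - prevControl uLast u k)))
        + (u k - prevControl uLast u k) ⬝ᵥ (s.Rt *ᵥ (u k - prevControl uLast u k)) := by
  rw [augState_add, stageCost, weight, Matrix.fromBlocks_mulVec]
  have h : u k ⬝ᵥ (s.Mᵀ *ᵥ s.traj x0 u k) = s.traj x0 u k ⬝ᵥ (s.M *ᵥ u k) := by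
    rw [dotProduct_mulVec_eq, Matrix.transpose_transpose, dotProduct_comm]
  simp only [sumElim_dotProduct_sumElim, dotProduct_add, Sum.elim_comp_inl, Sum.elim_comp_inr, h]
  ring

lemma stageCost_nonneg (hW : s.weight.PosDef) (hRt : s.Rt.PosDef) (x0 : Fin n → ℝ)
    (uLast : Fin m → ℝ) (u : ℕ → Fin m → ℝ) (k : ℕ) : 0 ≤ s.stageCost x0 uLast u k := by
  rw [stageCost_eq]
  exact add_nonneg (hW.posSemidef.dotProduct_nonneg _) (hRt.posSemidef.dotProduct_nonneg _)

lemma IsBellmanStep.stageCost_add (hW : s.weight.PosDef) (hRt : s.Rt.PosDef)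
    {Z' Z : Matrix (Fin n ⊕ Fin m) (Fin n ⊕ Fin m) ℝ} (h : s.IsBellmanStep Z' Z) :
    ∃ G : Matrix (Fin m) (Fin m) ℝ, G.PosDef ∧ ∀ x0 uLast (u : ℕ → Fin m → ℝ) (k : ℕ),
      s.stageCost x0 uLast u k
        + s.augState x0 uLast u (k + 1) ⬝ᵥ (Z' *ᵥ s.augState x0 uLast u (k + 1))
      = s.augState x0 uLast u k ⬝ᵥ (Z *ᵥ s.augState x0 uLast u k)
        + (u k - prevControl uLast u k + (s.Rt⁻¹ * sel n m * Z) *ᵥ s.augState x0 uLast u k) ⬝ᵥ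
          (G *ᵥ (u k - prevControl uLast u k
            + (s.Rt⁻¹ * sel n m * Z) *ᵥ s.augState x0 uLast u k)) := by
  obtain ⟨G, hG, hsq⟩ := h.completed_square hW hRt
  exact ⟨G, hG, fun x0 uLast u k => by rw [stageCost_eq, augState_succ, hsq]⟩

/-- Dropping the nonnegative square from the Bellman identity at each stage makes the j-stage value
a lower bound for the cost of any control. -/
lemma valueMat_le_sum_stageCost (hW : s.weight.PosDef) (hRt : s.Rt.PosDef) (x0 : Fin n → ℝ)
    (uLast : Fin m → ℝ) (u : ℕ → Fin m → ℝ) (j k : ℕ) :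
    s.augState x0 uLast u k ⬝ᵥ (s.valueMat j *ᵥ s.augState x0 uLast u k)
      ≤ ∑ i ∈ Finset.range j, s.stageCost x0 uLast u (k + i) := by
  induction j generalizing k with
  | zero => simp [valueMat, info]
  | succ j ih =>
    obtain ⟨G, hG, h⟩ := (isBellmanStep_valueMat hW hRt j).stageCost_add hW hRt
    have h1 := h x0 uLast u k
    have h2 := ih (k + 1)
    have h3 := hG.posSemidef.dotProduct_nonneg
      (u k - prevControl uLast u k
        + (s.Rt⁻¹ * sel n m * s.valueMat (j + 1)) *ᵥ s.augState x0 uLast u k)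
    simp only [Nat.add_right_comm k 1, Nat.add_assoc] at h2
    rw [Finset.sum_range_succ', add_zero]
    linarith

lemma le_cost (hW : s.weight.PosDef) (hRt : s.Rt.PosDef) (x0 : Fin n → ℝ)
    (uLast : Fin m → ℝ) (u : ℕ → Fin m → ℝ) (j : ℕ) :
    ENNReal.ofReal (∑ i ∈ Finset.range j, s.stageCost x0 uLast u i) ≤ s.cost x0 uLast u := by
  rw [ENNReal.ofReal_sum_of_nonneg fun i _ => stageCost_nonneg hW hRt x0 uLast u i]
  exact ENNReal.sum_le_tsum _

/-- State sequence under the feedback `v = -K χ`. -/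
noncomputable def feedbackState (s : LqrData n m) (K : Matrix (Fin m) (Fin n ⊕ Fin m) ℝ)
    (χ : Fin n ⊕ Fin m → ℝ) : ℕ → Fin n ⊕ Fin m → ℝ
  | 0 => χ
  | k + 1 => s.Phi *ᵥ (feedbackState s K χ k - (sel n m)ᵀ *ᵥ (K *ᵥ feedbackState s K χ k))

lemma exists_feedback (K : Matrix (Fin m) (Fin n ⊕ Fin m) ℝ) (x0 : Fin n → ℝ)
    (uLast : Fin m → ℝ) :
    ∃ u : ℕ → Fin m → ℝ, ∀ k,
      u k - prevControl uLast u k + K *ᵥ s.augState x0 uLast u k = 0 := by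
  set χ := feedbackState s K (Sum.elim x0 uLast)
  let u : ℕ → Fin m → ℝ := fun k => sel n m *ᵥ (χ k - (sel n m)ᵀ *ᵥ (K *ᵥ χ k))
  have hu : ∀ k, u k = sel n m *ᵥ χ k - K *ᵥ χ k := fun k => by
    simp only [u]
    rw [Matrix.mulVec_sub, Matrix.mulVec_mulVec, sel_mul_transpose, Matrix.one_mulVec]
  have hprev : ∀ k, s.augState x0 uLast u k = χ k →
      u k - prevControl uLast u k = - K *ᵥ χ k := fun k hk => by
    rw [hu, ← hk, augState, sel_mulVec]
    simp [Matrix.neg_mulVec]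
  have key : ∀ k, s.augState x0 uLast u k = χ k := by
    intro k
    induction k with
    | zero => rfl
    | succ k ih =>
      rw [augState_succ, hprev k ih, ih, Matrix.neg_mulVec, Matrix.mulVec_neg, ← sub_eq_add_neg]
      rfl
  refine ⟨u, fun k => ?_⟩
  rw [hprev k (key k), key, Matrix.neg_mulVec, neg_add_cancel]

lemma exists_cost_le (hW : s.weight.PosDef) (hRt : s.Rt.PosDef)
    {Z : Matrix (Fin n ⊕ Fin m) (Fin n ⊕ Fin m) ℝ} (hZ : s.IsBellmanStep Z Z) (x0 : Fin n → ℝ)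
    (uLast : Fin m → ℝ) :
    ∃ u : ℕ → Fin m → ℝ,
      u 0 = uLast + (s.Rt⁻¹ * sel n m * Z) *ᵥ (0 - Sum.elim x0 uLast) ∧
      s.cost x0 uLast u
        ≤ ENNReal.ofReal (Sum.elim x0 uLast ⬝ᵥ (Z *ᵥ Sum.elim x0 uLast)) := by
  obtain ⟨u, hu⟩ := exists_feedback (s := s) (s.Rt⁻¹ * sel n m * Z) x0 uLast
  obtain ⟨G, hG, hstep⟩ := hZ.stageCost_add hW hRt
  refine ⟨u, ?_, ?_⟩
  · have h := hu 0
    simp only [augState, traj, prevControl] at h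
    rw [zero_sub, Matrix.mulVec_neg]
    rw [← sub_eq_zero, ← h]
    abel
  · have hsum : ∀ j, ∑ i ∈ Finset.range j, s.stageCost x0 uLast u i
        + s.augState x0 uLast u j ⬝ᵥ (Z *ᵥ s.augState x0 uLast u j)
        = Sum.elim x0 uLast ⬝ᵥ (Z *ᵥ Sum.elim x0 uLast) := by
      intro j
      induction j with
      | zero => simp [augState, traj, prevControl]
      | succ j ih =>
        have h := hstep x0 uLast u j
        rw [hu, zero_dotProduct, add_zero] at h
        rw [Finset.sum_range_succ, add_assoc, h, ih]
    refine ENNReal.tsum_le_of_sum_range_le fun j => ?_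
    rw [← ENNReal.ofReal_sum_of_nonneg fun i _ => stageCost_nonneg hW hRt x0 uLast u i]
    refine ENNReal.ofReal_le_ofReal ?_
    rw [← hsum j]
    exact le_add_of_nonneg_right (hZ.posSemidef_right.dotProduct_nonneg _)

/-- Every cost is at least the limit of the finite-stage values, and the feedback from Z attains it.
For uniqueness, an optimal first increment that deviates by δ from the feedback would cost an extra
δᵀGδ. -/
lemma isLqrGain_iff (hW : s.weight.PosDef) (hRt : s.Rt.PosDef)
    {Z : Matrix (Fin n ⊕ Fin m) (Fin n ⊕ Fin m) ℝ} (hZ : s.IsBellmanStep Z Z)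
    (hlim : Tendsto s.valueMat atTop (𝓝 Z)) (K : Matrix (Fin m) (Fin n ⊕ Fin m) ℝ) :
    s.IsLqrGain K ↔ K = s.Rt⁻¹ * sel n m * Z := by
  constructor
  · intro hK
    have key : ∀ χ : Fin n ⊕ Fin m → ℝ, K *ᵥ χ = (s.Rt⁻¹ * sel n m * Z) *ᵥ χ := by
      intro χ
      set x0 : Fin n → ℝ := fun i => χ (Sum.inl i)
      set uLast : Fin m → ℝ := fun i => χ (Sum.inr i)
      have hχ : Sum.elim x0 uLast = χ := by ext (i | i) <;> rfl
      obtain ⟨u, hu0, hu⟩ := hK x0 uLast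
      obtain ⟨w, -, hw⟩ := exists_cost_le hW hRt hZ x0 uLast
      obtain ⟨G, hG, hstep⟩ := hZ.stageCost_add hW hRt
      have hs := hstep x0 uLast u 0
      have hχ0 : s.augState x0 uLast u 0 = χ := hχ
      -- The cost after time 0 is bounded below by finite-stage values, since `u` is not known to be
      -- a feedback. Letting j → ∞ puts Z in their place.
      have hbound : ∀ j, s.stageCost x0 uLast u 0
          + s.augState x0 uLast u 1 ⬝ᵥ (s.valueMat j *ᵥ s.augState x0 uLast u 1)
          ≤ χ ⬝ᵥ (Z *ᵥ χ) := by
        intro j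
        have h1 := valueMat_le_sum_stageCost hW hRt x0 uLast u j 1
        have h2 := (le_cost hW hRt x0 uLast u (j + 1)).trans ((hu w).trans hw)
        rw [hχ, ENNReal.ofReal_le_ofReal_iff (hZ.posSemidef_right.dotProduct_nonneg _),
          Finset.sum_range_succ'] at h2
        simp only [Nat.add_comm 1] at h1
        linarith
      have hlim' := le_of_tendsto' ((Matrix.tendsto_dotProduct_mulVec hlim
        (s.augState x0 uLast u 1)).const_add (s.stageCost x0 uLast u 0)) hbound
      rw [zero_add, hχ0] at hs
      set δ := u 0 - prevControl uLast u 0 + (s.Rt⁻¹ * sel n m * Z) *ᵥ χ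
      have hδ : δ = 0 := by
        by_contra hne
        have := hG.dotProduct_pos hne
        linarith
      have e : δ = (s.Rt⁻¹ * sel n m * Z) *ᵥ χ - K *ᵥ χ := by
        simp only [δ, hu0, hχ, prevControl, zero_sub, Matrix.mulVec_neg]
        abel
      rw [e, sub_eq_zero] at hδ
      exact hδ.symm
    exact Matrix.ext_of_mulVec_single fun i => key _
  · rintro rfl x0 uLast
    obtain ⟨u, hu0, hu⟩ := exists_cost_le hW hRt hZ x0 uLast
    refine ⟨u, hu0, fun v => hu.trans ?_⟩
    have h1 : ∀ j, ENNReal.ofReal (Sum.elim x0 uLast ⬝ᵥ (s.valueMat j *ᵥ Sum.elim x0 uLast))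
        ≤ s.cost x0 uLast v := fun j => by
      refine (ENNReal.ofReal_le_ofReal ?_).trans (le_cost hW hRt x0 uLast v j)
      have := valueMat_le_sum_stageCost hW hRt x0 uLast v j 0
      simpa [augState, traj, prevControl] using this
    exact le_of_tendsto' ((ENNReal.continuous_ofReal.tendsto _).comp
      (Matrix.tendsto_dotProduct_mulVec hlim _)) h1

end LqrData

lemma exists_tendsto_of_norm_sub_le {V : Type*} [NormedAddCommGroup V] [CompleteSpace V]
    {a : ℕ → V} {e : ℕ → ℝ} (he : Tendsto e atTop (𝓝 0))
    (h : ∀ N j, ‖a (N + j) - a N‖ ≤ e N) :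
    ∃ L, Tendsto a atTop (𝓝 L) ∧ ∀ N, ‖L - a N‖ ≤ e N := by
  have hc : CauchySeq a := by
    refine cauchySeq_of_le_tendsto_0' e (fun N M hNM => ?_) he
    obtain ⟨j, rfl⟩ := Nat.exists_eq_add_of_le hNM
    rw [dist_comm, dist_eq_norm]
    exact h N j
  obtain ⟨L, hL⟩ := cauchySeq_tendsto_of_complete hc
  refine ⟨L, hL, fun N => ?_⟩
  have h1 : Tendsto (fun j => ‖a (N + j) - a N‖) atTop (𝓝 ‖L - a N‖) :=
    ((((tendsto_add_atTop_iff_nat N).2 hL).congr fun j => by rw [add_comm]).sub_const _).norm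
  exact le_of_tendsto' h1 (h N)

lemma Matrix.l2_opNorm_mul_le {ι κ l : Type*} [Fintype ι] [Fintype κ] [Fintype l] [DecidableEq ι]
    [DecidableEq κ] [DecidableEq l] {A : Matrix ι κ ℝ} {B : Matrix κ l ℝ} {a b : ℝ} (hA : ‖A‖ ≤ a)
    (hB : ‖B‖ ≤ b) : ‖A * B‖ ≤ a * b :=
  (Matrix.l2_opNorm_mul A B).trans
    (mul_le_mul hA hB (norm_nonneg _) ((norm_nonneg _).trans hA))

namespace LqrData

open Riccati

variable {n m : ℕ} {s : LqrData n m}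

/-! ### Consequences of controllability -/

/-- The augmented pair `(Φ, [0; 1])` is controllable. -/
lemma Controllable.exists_one_eq_sum (hc : s.Controllable) :
    ∃ L : ℕ → Matrix (Fin m) (Fin n ⊕ Fin m) ℝ,
      1 = ∑ j ∈ Finset.range (n + 1), s.Phi ^ j * (sel n m)ᵀ * L j := by
  let J : Matrix (Fin n ⊕ Fin m) (Fin n) ℝ := Matrix.fromRows 1 0
  have hJ1 : s.Phi * J = J * s.A := by
    ext (i | i) j <;> simp [J, Phi, Matrix.fromBlocks_mul_fromRows, Matrix.fromRows_mul]
  have hE1 : s.Phi * (sel n m)ᵀ = J * s.B + (sel n m)ᵀ := by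
    ext (i | i) j <;>
      simp [J, Phi, sel, Matrix.transpose_fromCols, Matrix.fromBlocks_mul_fromRows,
        Matrix.fromRows_mul]
  have hone : (1 : Matrix (Fin n ⊕ Fin m) (Fin n ⊕ Fin m) ℝ) = J * Jᵀ + (sel n m)ᵀ * sel n m := by
    ext (i | i) (j | j) <;>
      simp [J, sel, Matrix.transpose_fromCols, Matrix.transpose_fromRows, Matrix.one_apply]
  have hpow : ∀ j, s.Phi ^ j * J = J * s.A ^ j := fun j => by
    induction j with
    | zero => simp
    | succ j ih => rw [pow_succ', Matrix.mul_assoc, ih, ← Matrix.mul_assoc, hJ1, Matrix.mul_assoc,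
        ← pow_succ']
  -- Since ΦEᵀ = JB + Eᵀ, each controllability block of (A, B) is a difference of consecutive blocks
  -- of (Φ, Eᵀ).
  have hdiff : ∀ j, J * (s.A ^ j * s.B) = s.Phi ^ (j + 1) * (sel n m)ᵀ - s.Phi ^ j * (sel n m)ᵀ :=
    fun j => by
      rw [pow_succ, Matrix.mul_assoc (s.Phi ^ j), hE1, Matrix.mul_add, ← Matrix.mul_assoc J, ← hpow,
        ← Matrix.mul_assoc]
      abel
  have hsurj : Function.Surjective (Matrix.mulVec (Matrix.of fun (i : Fin n) (p : Fin n × Fin m) =>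
      (s.A ^ (p.1 : ℕ) * s.B) i p.2)) := by
    have h := hc
    unfold Controllable Matrix.rank at h
    have htop := Submodule.eq_top_of_finrank_eq (h.trans (by simp))
    exact LinearMap.range_eq_top.1 htop
  obtain ⟨Y, hY⟩ := Matrix.mulVec_surjective_iff_exists_right_inverse.1 hsurj
  let Yj : ℕ → Matrix (Fin m) (Fin n) ℝ := fun j =>
    if h : j < n then Matrix.of fun a b => Y (⟨j, h⟩, a) b else 0
  have hsum : (1 : Matrix (Fin n) (Fin n) ℝ)
      = ∑ j ∈ Finset.range n, s.A ^ j * s.B * Yj j := by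
    rw [← hY, Finset.sum_range]
    ext i b
    rw [Matrix.mul_apply, Fintype.sum_prod_type, Matrix.sum_apply]
    refine Finset.sum_congr rfl fun j _ => ?_
    rw [Matrix.mul_apply]
    simp [Yj]
  have hJ : J * Jᵀ = ∑ j ∈ Finset.range n,
      (s.Phi ^ (j + 1) * (sel n m)ᵀ - s.Phi ^ j * (sel n m)ᵀ) * (Yj j * Jᵀ) := by
    calc J * Jᵀ = J * (1 : Matrix (Fin n) (Fin n) ℝ) * Jᵀ := by rw [Matrix.mul_one]
      _ = _ := by
        rw [hsum, Matrix.mul_sum, Matrix.sum_mul]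
        refine Finset.sum_congr rfl fun j _ => ?_
        rw [← hdiff]
        simp only [Matrix.mul_assoc]
  -- These are the coefficients of Φ^j Eᵀ once the differences are collected by powers, with E added
  -- at j = 0 for the control block of the identity.
  refine ⟨fun j => (if j = 0 then 0 else Yj (j - 1) * Jᵀ) - (if j = n then 0 else Yj j * Jᵀ)
    + (if j = 0 then sel n m else 0), ?_⟩
  have e1 : ∑ j ∈ Finset.range (n + 1), s.Phi ^ j * (sel n m)ᵀ *
      (if j = 0 then 0 else Yj (j - 1) * Jᵀ)
      = ∑ j ∈ Finset.range n, s.Phi ^ (j + 1) * (sel n m)ᵀ * (Yj j * Jᵀ) := by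
    rw [Finset.sum_range_succ']
    simp
  have e2 : ∑ j ∈ Finset.range (n + 1), s.Phi ^ j * (sel n m)ᵀ *
      (if j = n then 0 else Yj j * Jᵀ)
      = ∑ j ∈ Finset.range n, s.Phi ^ j * (sel n m)ᵀ * (Yj j * Jᵀ) := by
    rw [Finset.sum_range_succ, if_pos rfl, Matrix.mul_zero, add_zero]
    refine Finset.sum_congr rfl fun j hj => ?_
    rw [if_neg (Finset.mem_range.1 hj).ne]
  have e3 : ∑ j ∈ Finset.range (n + 1), s.Phi ^ j * (sel n m)ᵀ * (if j = 0 then sel n m else 0)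
      = (sel n m)ᵀ * sel n m := by
    rw [Finset.sum_range_succ']
    simp
  simp only [Matrix.mul_add, Matrix.mul_sub, Finset.sum_add_distrib, Finset.sum_sub_distrib]
  rw [e1, e2, e3, hone, hJ, ← Finset.sum_sub_distrib]
  simp only [Matrix.sub_mul]

lemma valueMat_le_of_steerable (hW : s.weight.PosDef) (hRt : s.Rt.PosDef) (k : ℕ)
    (w : ℕ → Fin m → ℝ) (χ : Fin n ⊕ Fin m → ℝ)
    (h : s.Phi ^ k *ᵥ χ
      + ∑ i ∈ Finset.range k, s.Phi ^ (i + 1) *ᵥ ((sel n m)ᵀ *ᵥ w i) = 0) :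
    ∃ c : ℝ, ∀ j, χ ⬝ᵥ (s.valueMat j *ᵥ χ) ≤ c := by
  induction k generalizing χ with
  | zero =>
    have : χ = 0 := by simpa using h
    exact ⟨0, fun j => by simp [this]⟩
  | succ k ih =>
    -- The increments are indexed backwards in time: `w k` carries the highest power of Φ and acts
    -- first.
    set y := χ + (sel n m)ᵀ *ᵥ w k with hy
    obtain ⟨c, hc⟩ := ih (s.Phi *ᵥ y) (by
      rw [← h, Finset.sum_range_succ, hy, Matrix.mulVec_mulVec, ← pow_succ, Matrix.mulVec_add]
      abel)
    have hc0 : 0 ≤ c := by simpa [valueMat, info] using hc 0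
    have h0 : 0 ≤ y ⬝ᵥ (s.weight *ᵥ y) + w k ⬝ᵥ (s.Rt *ᵥ w k) :=
      add_nonneg (hW.posSemidef.dotProduct_nonneg _) (hRt.posSemidef.dotProduct_nonneg _)
    refine ⟨y ⬝ᵥ (s.weight *ᵥ y) + w k ⬝ᵥ (s.Rt *ᵥ w k) + c, fun j => ?_⟩
    cases j with
    | zero => simpa [valueMat, info] using add_nonneg h0 hc0
    | succ j =>
      obtain ⟨G, hG, hsq⟩ := (isBellmanStep_valueMat hW hRt j).completed_square hW hRt
      have h1 := hsq χ (w k)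
      rw [← hy] at h1
      have h2 := hG.posSemidef.dotProduct_nonneg
        (w k + (s.Rt⁻¹ * sel n m * s.valueMat (j + 1)) *ᵥ χ)
      have h3 := hc j
      linarith

lemma Controllable.exists_valueMat_le (hc : s.Controllable) (hW : s.weight.PosDef)
    (hRt : s.Rt.PosDef) (χ : Fin n ⊕ Fin m → ℝ) :
    ∃ c : ℝ, ∀ j, χ ⬝ᵥ (s.valueMat j *ᵥ χ) ≤ c := by
  obtain ⟨L, hL⟩ := hc.exists_one_eq_sum
  -- An increment acts before Φ, so the decomposition of 1 is multiplied by Φ on the left and Φ^n on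
  -- the right to cancel Φ^(n+1)χ.
  refine valueMat_le_of_steerable hW hRt (n + 1) (fun j => -((L j * s.Phi ^ n) *ᵥ χ)) χ ?_
  have h : s.Phi ^ (n + 1) = ∑ j ∈ Finset.range (n + 1),
      s.Phi ^ (j + 1) * ((sel n m)ᵀ * (L j * s.Phi ^ n)) := by
    calc s.Phi ^ (n + 1) = s.Phi * 1 * s.Phi ^ n := by rw [Matrix.mul_one, pow_succ']
      _ = _ := by
        rw [hL, Matrix.mul_sum, Matrix.sum_mul]
        refine Finset.sum_congr rfl fun j _ => ?_
        rw [pow_succ']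
        simp only [Matrix.mul_assoc]
  simp only [Matrix.mulVec_neg, Matrix.mulVec_mulVec, Finset.sum_neg_distrib]
  rw [← Matrix.sum_mulVec, ← h, add_neg_cancel]

lemma exists_trace_valueMat_le (hW : s.weight.PosDef) (hRt : s.Rt.PosDef) (hc : s.Controllable) :
    ∃ b : ℝ, 0 ≤ b ∧ ∀ j, (s.valueMat j).trace ≤ b := by
  choose c h using fun i : Fin n ⊕ Fin m => hc.exists_valueMat_le hW hRt (Pi.single i 1)
  have h' : ∀ j, (s.valueMat j).trace ≤ ∑ i, c i := fun j => by
    refine Finset.sum_le_sum fun i _ => ?_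
    simpa [Matrix.mulVec_single_one] using h i j
  exact ⟨∑ i, c i, by simpa [valueMat, info] using h' 0, h'⟩

/-- The information gathered is bounded, uniformly in the prior covariance. -/
lemma exists_norm_info_le (hW : s.weight.PosDef) (hRt : s.Rt.PosDef) (hc : s.Controllable) :
    ∃ b : ℝ, 0 < b ∧ ∀ j, ∀ Y : Matrix (Fin n ⊕ Fin m) (Fin n ⊕ Fin m) ℝ, Y.PosSemidef →
      ‖info s.Phi s.measCov s.procCov j Y‖ ≤ b := by
  obtain ⟨b, hb0, hb⟩ := exists_trace_valueMat_le hW hRt hc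
  obtain ⟨t, ht0, ht⟩ := Matrix.exists_trace_le_l2_opNorm (Fin n ⊕ Fin m)
  refine ⟨t * (‖s.weight‖ + ‖s.Phi‖ * b * ‖s.Phi‖) + 1, by positivity, fun j Y hY => ?_⟩
  have hR := measCov_posDef hW
  have hQ := procCov_posSemidef hRt
  cases j with
  | zero => simp only [info, norm_zero]; positivity
  | succ j =>
    have h1 := (info_posSemidef (Φ := s.Phi) hR hQ hY (j + 1)).l2_opNorm_le_trace
    have h2 := (info_le_info_zero (Φ := s.Phi) hR hQ hY (j + 1)).trace_nonneg
    rw [Matrix.trace_sub, info_zero_succ hW] at h2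
    have h3 := ht (s.weight + s.Phiᵀ * s.valueMat j * s.Phi)
    have h4 : ‖s.Phiᵀ * s.valueMat j * s.Phi‖ ≤ ‖s.Phi‖ * b * ‖s.Phi‖ :=
      Matrix.l2_opNorm_mul_le (Matrix.l2_opNorm_mul_le (Matrix.l2_opNorm_transpose _).le
        ((valueMat_posSemidef hW hRt j).l2_opNorm_le_trace.trans (hb j))) le_rfl
    have h5 := mul_le_mul_of_nonneg_left
      ((norm_add_le s.weight (s.Phiᵀ * s.valueMat j * s.Phi)).trans (add_le_add le_rfl h4)) ht0.le
    linarith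

lemma exists_norm_innov_le (hW : s.weight.PosDef) (hRt : s.Rt.PosDef) (hc : s.Controllable) :
    ∃ b : ℝ, 0 < b ∧ ∀ Y : Matrix (Fin n ⊕ Fin m) (Fin n ⊕ Fin m) ℝ, Y.PosSemidef →
      ‖(Y + s.measCov)⁻¹‖ ≤ b := by
  obtain ⟨b, hb0, hb⟩ := exists_norm_info_le hW hRt hc
  exact ⟨b, hb0, fun Y hY => by simpa [info] using hb 1 Y hY⟩

/-- The new prior depends on the old one only through (P_k + R)⁻¹, which is bounded as the
information of a single measurement. -/
lemma exists_norm_priorCov_le (hW : s.weight.PosDef) (hRt : s.Rt.PosDef) (hc : s.Controllable) :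
    ∃ p : ℝ, 0 < p ∧ ∀ k, ‖s.priorCov k‖ ≤ p := by
  obtain ⟨b, hb0, hb⟩ := exists_norm_innov_le hW hRt hc
  refine ⟨‖s.Phi‖ * (‖s.measCov‖ + ‖s.measCov‖ * b * ‖s.measCov‖) * ‖s.Phi‖ + ‖s.procCov‖ + 1,
    by positivity, fun k => ?_⟩
  cases k with
  | zero =>
    have : 0 ≤ ‖s.Phi‖ * (‖s.measCov‖ + ‖s.measCov‖ * b * ‖s.measCov‖) * ‖s.Phi‖ := by positivity
    simp only [priorCov]
    linarith
  | succ k =>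
    rw [priorCov_eq hW hRt, Function.iterate_succ_apply', ← priorCov_eq hW hRt, step]
    refine (norm_add_le _ _).trans ?_
    have h1 : ‖s.Phi * (s.measCov - s.measCov * (s.priorCov k + s.measCov)⁻¹ * s.measCov) * s.Phiᵀ‖
        ≤ ‖s.Phi‖ * (‖s.measCov‖ + ‖s.measCov‖ * b * ‖s.measCov‖) * ‖s.Phi‖ := by
      refine Matrix.l2_opNorm_mul_le (Matrix.l2_opNorm_mul_le le_rfl ?_)
        (Matrix.l2_opNorm_transpose _).le
      refine (norm_sub_le _ _).trans (add_le_add le_rfl ?_)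
      exact Matrix.l2_opNorm_mul_le (Matrix.l2_opNorm_mul_le le_rfl
        (hb _ (priorCov_posSemidef hW hRt k))) le_rfl
    linarith

lemma exists_sq_norm_le_innov (hW : s.weight.PosDef) (hRt : s.Rt.PosDef) (hc : s.Controllable) :
    ∃ β : ℝ, 0 < β ∧ ∀ (k : ℕ) {κ : Type} [Fintype κ] [DecidableEq κ]
      (N : Matrix (Fin n ⊕ Fin m) κ ℝ),
      ‖N‖ ^ 2 ≤ β * ‖Nᵀ * s.innov k * N‖ := by
  obtain ⟨p, hp0, hp⟩ := exists_norm_priorCov_le hW hRt hc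
  refine ⟨p + ‖s.measCov‖, by positivity, fun k κ _ _ N => ?_⟩
  have h := (posDef_add (measCov_posDef hW) (priorCov_posSemidef hW hRt k)).l2_opNorm_sq_le N
  refine h.trans (mul_le_mul_of_nonneg_right ?_ (norm_nonneg _))
  exact (norm_add_le _ _).trans (add_le_add (hp k) le_rfl)

lemma exists_norm_closed_priorCov_le (hW : s.weight.PosDef) (hRt : s.Rt.PosDef)
    (hc : s.Controllable) :
    ∃ ℓ : ℝ, 0 ≤ ℓ ∧ ∀ N, ‖closed s.Phi s.measCov (s.priorCov N)‖ ≤ ℓ := by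
  obtain ⟨a, ha0, ha⟩ := exists_norm_innov_le hW hRt hc
  exact ⟨‖s.Phi‖ * ‖s.measCov‖ * a, by positivity, fun N =>
    Matrix.l2_opNorm_mul_le (Matrix.l2_opNorm_mul_le le_rfl le_rfl)
      (ha _ (priorCov_posSemidef hW hRt N))⟩

/-- The closed-loop products are dominated by their action on the control block. -/
lemma exists_norm_closedLoopProd_le (hW : s.weight.PosDef) (hRt : s.Rt.PosDef)
    (hc : s.Controllable) :
    ∃ c : ℝ, 0 < c ∧ ∀ N, ‖s.closedLoopProd N‖ ≤ c * ‖s.closedLoopProd N * (sel n m)ᵀ‖ := by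
  have hR := measCov_posDef hW
  have hQ := procCov_posSemidef hRt
  obtain ⟨b, hb0, hb⟩ := exists_norm_info_le hW hRt hc
  obtain ⟨ℓ, hℓ, hcl⟩ := exists_norm_closed_priorCov_le hW hRt hc
  -- Both sides are T_{N+1}(0), on the right compared with prior Q. As Q = EᵀR̃⁻¹E, the correction
  -- passes through T_N Eᵀ, which lets the bound propagate from T_N Φ^j Eᵀ to T_N Φ^(j+1) Eᵀ.
  have hPhi : ∀ N, s.closedLoopProd N * s.Phi = closed s.Phi s.measCov (s.priorCov N)
      * (s.closedLoopProd N + s.closedLoopProd N * (sel n m)ᵀ *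
        (s.Rt⁻¹ * sel n m * info s.Phi s.measCov s.procCov (N + 1) 0)) := by
    intro N
    have h := trans_eq_mul (Φ := s.Phi) hR hQ hQ Matrix.PosSemidef.zero (N + 1)
    rw [Riccati.trans, closed_zero hR, step_zero hR, trans_succ,
      ← priorCov_eq hW hRt, ← closedLoopProd_eq hW hRt, sub_zero] at h
    rw [h, Matrix.mul_assoc, Matrix.mul_add, Matrix.mul_one]
    generalize info s.Phi s.measCov s.procCov (N + 1) 0 = V
    rw [procCov_eq]
    simp only [Matrix.mul_assoc]
  set e := ‖s.Rt⁻¹ * sel n m‖ * b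
  have he : 0 ≤ e := by positivity
  have hstep : ∀ j, ∃ c : ℝ, 0 ≤ c ∧ ∀ N, ‖s.closedLoopProd N * (s.Phi ^ j * (sel n m)ᵀ)‖
      ≤ c * ‖s.closedLoopProd N * (sel n m)ᵀ‖ := by
    intro j
    induction j with
    | zero => exact ⟨1, zero_le_one, fun N => by simp⟩
    | succ j ih =>
      obtain ⟨c, hc0, hc⟩ := ih
      refine ⟨ℓ * (c + e * ‖s.Phi ^ j * (sel n m)ᵀ‖), by positivity, fun N => ?_⟩
      have e1 : s.closedLoopProd N * (s.Phi ^ (j + 1) * (sel n m)ᵀ)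
          = closed s.Phi s.measCov (s.priorCov N)
            * (s.closedLoopProd N * (s.Phi ^ j * (sel n m)ᵀ)
              + s.closedLoopProd N * (sel n m)ᵀ * ((s.Rt⁻¹ * sel n m *
                info s.Phi s.measCov s.procCov (N + 1) 0) * (s.Phi ^ j * (sel n m)ᵀ))) := by
        rw [pow_succ', Matrix.mul_assoc, ← Matrix.mul_assoc (s.closedLoopProd N), hPhi N]
        simp only [Matrix.mul_assoc, Matrix.add_mul]
      have h2 : ‖(s.Rt⁻¹ * sel n m * info s.Phi s.measCov s.procCov (N + 1) 0)
          * (s.Phi ^ j * (sel n m)ᵀ)‖ ≤ e * ‖s.Phi ^ j * (sel n m)ᵀ‖ :=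
        Matrix.l2_opNorm_mul_le (Matrix.l2_opNorm_mul_le le_rfl
          (hb _ _ Matrix.PosSemidef.zero)) le_rfl
      rw [e1]
      calc _ ≤ ℓ * (c * ‖s.closedLoopProd N * (sel n m)ᵀ‖
            + ‖s.closedLoopProd N * (sel n m)ᵀ‖ * (e * ‖s.Phi ^ j * (sel n m)ᵀ‖)) :=
            Matrix.l2_opNorm_mul_le (hcl N) ((norm_add_le _ _).trans
              (add_le_add (hc N) (Matrix.l2_opNorm_mul_le le_rfl h2)))
        _ = _ := by ring
  choose c hc0 hcc using hstep
  obtain ⟨L, hL⟩ := hc.exists_one_eq_sum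
  refine ⟨∑ j ∈ Finset.range (n + 1), c j * ‖L j‖ + 1, ?_, fun N => ?_⟩
  · have : 0 ≤ ∑ j ∈ Finset.range (n + 1), c j * ‖L j‖ :=
      Finset.sum_nonneg fun j _ => mul_nonneg (hc0 j) (norm_nonneg _)
    linarith
  · have h1 : s.closedLoopProd N = ∑ j ∈ Finset.range (n + 1),
        s.closedLoopProd N * (s.Phi ^ j * (sel n m)ᵀ) * L j := by
      conv_lhs => rw [← Matrix.mul_one (s.closedLoopProd N), hL, Matrix.mul_sum]
      simp only [Matrix.mul_assoc]
    have h2 : ‖s.closedLoopProd N‖ ≤ ∑ j ∈ Finset.range (n + 1),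
        c j * ‖s.closedLoopProd N * (sel n m)ᵀ‖ * ‖L j‖ := by
      conv_lhs => rw [h1]
      exact (norm_sum_le _ _).trans (Finset.sum_le_sum fun j _ =>
        Matrix.l2_opNorm_mul_le (hcc j N) le_rfl)
    refine h2.trans ?_
    rw [add_mul, one_mul, Finset.sum_mul]
    refine le_add_of_le_of_nonneg (le_of_eq (Finset.sum_congr rfl fun j _ => by ring))
      (norm_nonneg _)

end LqrData

lemma Riccati.trans_of_fixed {ι : Type*} [Fintype ι] [DecidableEq ι] {Φ R Q Y : Matrix ι ι ℝ}
    (h : Riccati.step Φ R Q Y = Y) (j : ℕ) :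
    Riccati.trans Φ R Q j Y = Riccati.closed Φ R Y ^ j := by
  induction j with
  | zero => rfl
  | succ j ih => rw [Riccati.trans, h, ih, pow_succ]

lemma mul_pow_succ_eq {M : Type*} [Monoid M] (a b : M) (N : ℕ) :
    (a * b) ^ (N + 1) = a * (b * a) ^ N * b := by
  induction N with
  | zero => simp
  | succ N ih => rw [pow_succ, ih, pow_succ (b * a)]; simp only [mul_assoc]

namespace LqrData

open Riccati

variable {n m : ℕ} {s : LqrData n m}

/-! ### Convergence -/

lemma increment_posSemidef (hW : s.weight.PosDef) (hRt : s.Rt.PosDef) (N : ℕ) :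
    ((s.closedLoopProd N)ᵀ * s.innov N * s.closedLoopProd N).PosSemidef :=
  posSemidef_congr_transpose
    (posDef_add (measCov_posDef hW) (priorCov_posSemidef hW hRt N)).inv.posSemidef _

/-- The traces of the value matrices increase and are bounded, so their increments tend to 0, and
each increment controls ‖T_N‖². -/
lemma tendsto_sq_norm_closedLoopProd (hW : s.weight.PosDef) (hRt : s.Rt.PosDef)
    (hc : s.Controllable) : Tendsto (fun N => ‖s.closedLoopProd N‖ ^ 2) atTop (𝓝 0) := by
  obtain ⟨β, hβ0, hβ⟩ := exists_sq_norm_le_innov hW hRt hc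
  obtain ⟨b, hb0, hb⟩ := exists_trace_valueMat_le hW hRt hc
  have hD := increment_posSemidef hW hRt
  have htr : ∀ N, (s.valueMat (N + 1)).trace - (s.valueMat N).trace
      = ((s.closedLoopProd N)ᵀ * s.innov N * s.closedLoopProd N).trace := fun N => by
    rw [valueMat_succ hW hRt, Matrix.trace_add]; ring
  have hmono : Monotone fun N => (s.valueMat N).trace := monotone_nat_of_le_succ fun N => by
    have := (hD N).trace_nonneg
    rw [← htr] at this
    linarith
  have hlim := tendsto_atTop_ciSup hmono ⟨b, by rintro _ ⟨N, rfl⟩; exact hb N⟩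
  have hz := (((tendsto_add_atTop_iff_nat 1).2 hlim).sub hlim).const_mul β
  rw [sub_self, mul_zero] at hz
  refine squeeze_zero (fun N => by positivity) (fun N => ?_) hz
  refine (hβ N (s.closedLoopProd N)).trans (mul_le_mul_of_nonneg_left ?_ hβ0.le)
  rw [htr]
  exact (hD N).l2_opNorm_le_trace

lemma valueMat_add_sub (hW : s.weight.PosDef) (hRt : s.Rt.PosDef) (N j : ℕ) :
    s.valueMat (N + j) - s.valueMat N
      = (s.closedLoopProd N)ᵀ * info s.Phi s.measCov s.procCov j (s.priorCov N)
        * s.closedLoopProd N := by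
  rw [valueMat, valueMat, info_add, ← priorCov_eq hW hRt, ← closedLoopProd_eq hW hRt]
  abel

lemma exists_tendsto_valueMat (hW : s.weight.PosDef) (hRt : s.Rt.PosDef) (hc : s.Controllable) :
    ∃ Z, Tendsto s.valueMat atTop (𝓝 Z) ∧
      ∃ c : ℝ, 0 < c ∧ ∀ N, ‖Z - s.valueMat N‖ ≤ c * ‖s.closedLoopProd N‖ ^ 2 := by
  obtain ⟨b, hb0, hb⟩ := exists_norm_info_le hW hRt hc
  have he := (tendsto_sq_norm_closedLoopProd hW hRt hc).const_mul b
  rw [mul_zero] at he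
  obtain ⟨Z, hZ, hZ'⟩ := exists_tendsto_of_norm_sub_le he (a := s.valueMat) fun N j => by
    rw [valueMat_add_sub hW hRt]
    refine (Matrix.l2_opNorm_mul_le (Matrix.l2_opNorm_mul_le (Matrix.l2_opNorm_transpose _).le
      (hb j _ (priorCov_posSemidef hW hRt N))) le_rfl).trans_eq ?_
    ring
  exact ⟨Z, hZ, b, hb0, hZ'⟩

lemma norm_trans_le (hW : s.weight.PosDef) (hRt : s.Rt.PosDef) {b : ℝ}
    (hb : ∀ j, ∀ Y : Matrix (Fin n ⊕ Fin m) (Fin n ⊕ Fin m) ℝ, Y.PosSemidef →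
      ‖info s.Phi s.measCov s.procCov j Y‖ ≤ b)
    {X Y : Matrix (Fin n ⊕ Fin m) (Fin n ⊕ Fin m) ℝ} (hX : X.PosSemidef) (hY : Y.PosSemidef)
    (j : ℕ) :
    ‖trans s.Phi s.measCov s.procCov j Y‖ ≤
      ‖trans s.Phi s.measCov s.procCov j X‖
        * (‖(1 : Matrix (Fin n ⊕ Fin m) (Fin n ⊕ Fin m) ℝ)‖ + (‖X‖ + ‖Y‖) * b) := by
  rw [trans_eq_mul (measCov_posDef hW) (procCov_posSemidef hRt) hX hY]
  exact Matrix.l2_opNorm_mul_le le_rfl ((norm_add_le _ _).trans (add_le_add le_rfl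
    (Matrix.l2_opNorm_mul_le (norm_sub_le _ _) (hb j Y hY))))

/-- P_{N+j} and P_N are the N-th iterates from P_j and P_0, so their difference factors through two
transition products, both O(‖T_N‖). -/
lemma exists_tendsto_priorCov (hW : s.weight.PosDef) (hRt : s.Rt.PosDef) (hc : s.Controllable) :
    ∃ P, Tendsto s.priorCov atTop (𝓝 P) := by
  obtain ⟨b, hb0, hb⟩ := exists_norm_info_le hW hRt hc
  obtain ⟨p, hp0, hp⟩ := exists_norm_priorCov_le hW hRt hc
  set e := ‖(1 : Matrix (Fin n ⊕ Fin m) (Fin n ⊕ Fin m) ℝ)‖ + (p + p) * b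
  have he := (tendsto_sq_norm_closedLoopProd hW hRt hc).const_mul (e * (p + p))
  rw [mul_zero] at he
  have hR := measCov_posDef hW
  have hQ := procCov_posSemidef hRt
  obtain ⟨P, hP, -⟩ := exists_tendsto_of_norm_sub_le he (a := s.priorCov) fun N j => by
    have hj := priorCov_posSemidef hW hRt j
    have h0 : ‖s.procCov‖ ≤ p := hp 0
    have h1 := norm_trans_le hW hRt hb hQ hj N
    rw [← closedLoopProd_eq hW hRt] at h1
    have h2 : s.priorCov (N + j) - s.priorCov N
        = trans s.Phi s.measCov s.procCov N (s.priorCov j) * (s.priorCov j - s.procCov)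
          * (s.closedLoopProd N)ᵀ := by
      rw [closedLoopProd_eq hW hRt, ← iterate_step_sub hR hQ hj hQ, priorCov_eq hW hRt,
        priorCov_eq hW hRt N, priorCov_eq hW hRt j, Function.iterate_add_apply]
    have h3 : ‖trans s.Phi s.measCov s.procCov N (s.priorCov j)‖ ≤ ‖s.closedLoopProd N‖ * e := by
      refine h1.trans (mul_le_mul_of_nonneg_left ?_ (norm_nonneg _))
      have := mul_le_mul_of_nonneg_right (add_le_add h0 (hp j)) hb0.le
      simp only [e]
      linarith
    rw [h2]
    refine (Matrix.l2_opNorm_mul_le (Matrix.l2_opNorm_mul_le h3 ((norm_sub_le _ _).trans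
      (add_le_add (hp j) h0))) (Matrix.l2_opNorm_transpose _).le).trans_eq ?_
    ring
  exact ⟨P, hP⟩

section Limit

variable {P : Matrix (Fin n ⊕ Fin m) (Fin n ⊕ Fin m) ℝ}

lemma limit_posSemidef (hW : s.weight.PosDef) (hRt : s.Rt.PosDef)
    (hP : Tendsto s.priorCov atTop (𝓝 P)) : P.PosSemidef :=
  Matrix.posSemidef_of_tendsto hP (Eventually.of_forall (priorCov_posSemidef hW hRt))

lemma tendsto_innov (hW : s.weight.PosDef) (hRt : s.Rt.PosDef)
    (hP : Tendsto s.priorCov atTop (𝓝 P)) :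
    Tendsto s.innov atTop (𝓝 (P + s.measCov)⁻¹) :=
  Matrix.tendsto_inv (hP.add_const _) ((Matrix.isUnit_iff_isUnit_det _).1
    (posDef_add (measCov_posDef hW) (limit_posSemidef hW hRt hP)).isUnit).ne_zero

lemma tendsto_kalmanGain (hW : s.weight.PosDef) (hRt : s.Rt.PosDef)
    (hP : Tendsto s.priorCov atTop (𝓝 P)) :
    Tendsto s.kalmanGain atTop (𝓝 (P * (P + s.measCov)⁻¹)) :=
  hP.mul (tendsto_innov hW hRt hP)

lemma step_limit (hW : s.weight.PosDef) (hRt : s.Rt.PosDef)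
    (hP : Tendsto s.priorCov atTop (𝓝 P)) : step s.Phi s.measCov s.procCov P = P := by
  have h1 : Tendsto (fun k => step s.Phi s.measCov s.procCov (s.priorCov k)) atTop
      (𝓝 (step s.Phi s.measCov s.procCov P)) :=
    (((((tendsto_innov hW hRt hP).const_mul s.measCov).mul_const s.measCov).const_sub
      s.measCov).const_mul s.Phi |>.mul_const s.Phiᵀ).add_const s.procCov
  refine tendsto_nhds_unique h1 (((tendsto_add_atTop_iff_nat 1).2 hP).congr fun k => ?_)
  rw [priorCov_eq hW hRt, Function.iterate_succ_apply', ← priorCov_eq hW hRt]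

/-- The time-varying closed loop is comparable to the powers of its limit. -/
lemma exists_norm_closedLoopProd_equiv (hW : s.weight.PosDef) (hRt : s.Rt.PosDef)
    (hc : s.Controllable) (hP : Tendsto s.priorCov atTop (𝓝 P)) :
    ∃ c : ℝ, 0 < c ∧ ∀ N, ‖s.closedLoopProd N‖ ≤ c * ‖closed s.Phi s.measCov P ^ N‖ ∧
      ‖closed s.Phi s.measCov P ^ N‖ ≤ c * ‖s.closedLoopProd N‖ := by
  obtain ⟨b, hb0, hb⟩ := exists_norm_info_le hW hRt hc
  have hPp := limit_posSemidef hW hRt hP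
  have hQ := procCov_posSemidef hRt
  refine ⟨‖(1 : Matrix (Fin n ⊕ Fin m) (Fin n ⊕ Fin m) ℝ)‖ + (‖P‖ + ‖s.procCov‖) * b + 1,
    by positivity, fun N => ?_⟩
  have h1 := norm_trans_le hW hRt hb hPp hQ N
  have h2 := norm_trans_le hW hRt hb hQ hPp N
  rw [trans_of_fixed (step_limit hW hRt hP), ← closedLoopProd_eq hW hRt] at h1 h2
  constructor
  · nlinarith [norm_nonneg (closed s.Phi s.measCov P ^ N)]
  · nlinarith [norm_nonneg (s.closedLoopProd N)]

lemma closed_limit (hW : s.weight.PosDef) (hRt : s.Rt.PosDef)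
    (hP : Tendsto s.priorCov atTop (𝓝 P)) :
    closed s.Phi s.measCov P = s.Phi * (1 - P * (P + s.measCov)⁻¹) := by
  rw [one_sub_gain (measCov_posDef hW) (limit_posSemidef hW hRt hP), closed, Matrix.mul_assoc]

end Limit

/-! ### Spectral data of the limiting closed loop -/

lemma closedLoop_pow (K : Matrix (Fin n ⊕ Fin m) (Fin n ⊕ Fin m) ℝ) (N : ℕ) :
    s.closedLoop K ^ N = (((1 - K) * s.Phi) ^ N).map (fun t : ℝ => (t : ℂ)) :=
  (map_pow (Complex.ofRealHom.mapMatrix) ((1 - K) * s.Phi) N).symm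

lemma lamMax_nonneg (K : Matrix (Fin n ⊕ Fin m) (Fin n ⊕ Fin m) ℝ) : 0 ≤ s.lamMax K :=
  ENNReal.toReal_nonneg

lemma lamMax_lt_one {K : Matrix (Fin n ⊕ Fin m) (Fin n ⊕ Fin m) ℝ}
    (h : Tendsto (fun N : ℕ => (s.Phi * (1 - K)) ^ N) atTop (𝓝 0)) : s.lamMax K < 1 := by
  refine Matrix.spectralRadius_lt_one_of_tendsto ?_
  rw [← tendsto_add_atTop_iff_nat 1]
  have hc : Continuous fun A : Matrix (Fin n ⊕ Fin m) (Fin n ⊕ Fin m) ℝ =>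
      A.map (fun t : ℝ => (t : ℂ)) := continuous_id.matrix_map Complex.continuous_ofReal
  have h1 := (hc.tendsto 0).comp ((h.const_mul (1 - K)).mul_const s.Phi |>.trans_eq ?_)
  swap
  · simp
  refine (h1.congr fun N => ?_).trans_eq (by simp)
  simp only [Function.comp_apply]
  rw [closedLoop_pow, mul_pow_succ_eq]

lemma lamMax_eq_zero {K : Matrix (Fin n ⊕ Fin m) (Fin n ⊕ Fin m) ℝ} {N : ℕ}
    (h : (s.Phi * (1 - K)) ^ N = 0) : s.lamMax K = 0 := by
  refine Matrix.spectralRadius_eq_zero_of_pow_eq_zero (N := N + 1) ?_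
  rw [closedLoop_pow, mul_pow_succ_eq, h]
  simp

/-- Reordering gives (Φ(1 − K))^(N+1) = Φ((1 − K)Φ)^N(1 − K). The lost exponent is harmless, because
the error at horizon N is governed by T_{N+1}; the form stays valid for r = 0. -/
lemma exists_norm_pow_le {K : Matrix (Fin n ⊕ Fin m) (Fin n ⊕ Fin m) ℝ} {r : ℝ} (hr : 0 ≤ r)
    (h : s.lamMax K < r ∨ (s.lamMax K = r ∧ s.DominantSemisimple K)) :
    ∃ c : ℝ, 0 < c ∧ ∀ N : ℕ, ‖(s.Phi * (1 - K)) ^ (N + 1)‖ ≤ c * r ^ N := by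
  obtain ⟨c, hc⟩ := Matrix.exists_entry_pow_le (M := s.closedLoop K) hr (by
    intro μ v hv0 hv
    have hμ : ‖μ‖ ≤ s.lamMax K :=
      Matrix.norm_le_spectralRadius_toReal (Matrix.mem_spectrum_iff_exists.2 ⟨v, hv0, hv⟩)
    rcases h with h | ⟨h, hs⟩
    · exact Or.inl (hμ.trans_lt h)
    · rcases hμ.lt_or_eq with hlt | heq
      · exact Or.inl (h ▸ hlt)
      · exact Or.inr ⟨heq.trans h, hs μ heq⟩)
  obtain ⟨d, hd0, hd⟩ := Matrix.exists_l2_opNorm_le_of_entries (Fin n ⊕ Fin m) (Fin n ⊕ Fin m)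
  refine ⟨‖s.Phi‖ * (d * |c|) * ‖1 - K‖ + 1, by positivity, fun N => ?_⟩
  have h1 : ‖((1 - K) * s.Phi) ^ N‖ ≤ d * (|c| * r ^ N) := by
    refine hd _ _ fun i j => ?_
    have h2 := hc N i j
    rw [closedLoop_pow, Matrix.map_apply, Complex.norm_real] at h2
    exact h2.trans (mul_le_mul_of_nonneg_right (le_abs_self c) (pow_nonneg hr N))
  rw [mul_pow_succ_eq]
  refine (Matrix.l2_opNorm_mul_le (Matrix.l2_opNorm_mul_le le_rfl h1) le_rfl).trans ?_
  have := pow_nonneg hr N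
  nlinarith

end LqrData

namespace LqrData

open Riccati

variable {n m : ℕ} {s : LqrData n m}

/-! ### Gain error and covariance increment -/

section Limit

variable {Z : Matrix (Fin n ⊕ Fin m) (Fin n ⊕ Fin m) ℝ}

lemma isBellmanStep_limit (hW : s.weight.PosDef) (hRt : s.Rt.PosDef)
    (hZ : Tendsto s.valueMat atTop (𝓝 Z)) : s.IsBellmanStep Z Z := by
  have hp : Z.PosSemidef :=
    Matrix.posSemidef_of_tendsto hZ (Eventually.of_forall (valueMat_posSemidef hW hRt))
  have hZ1 := (tendsto_add_atTop_iff_nat 1).2 hZ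
  have hU : Tendsto (fun k => s.weight + s.Phiᵀ * s.valueMat k * s.Phi) atTop
      (𝓝 (s.weight + s.Phiᵀ * Z * s.Phi)) :=
    ((hZ.const_mul s.Phiᵀ).mul_const s.Phi).const_add s.weight
  refine ⟨hp, hp, tendsto_nhds_unique ((hU.sub hZ1).congr fun k => ?_)
    ((hZ1.mul_const s.procCov).mul hU)⟩
  exact (isBellmanStep_valueMat hW hRt k).eq

lemma limit_sub_valueMat_posSemidef (hW : s.weight.PosDef) (hRt : s.Rt.PosDef)
    (hZ : Tendsto s.valueMat atTop (𝓝 Z)) (N : ℕ) : (Z - s.valueMat N).PosSemidef := by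
  refine Matrix.posSemidef_of_tendsto (hZ.sub_const _) ?_
  filter_upwards [eventually_ge_atTop N] with k hk
  obtain ⟨j, rfl⟩ := Nat.exists_eq_add_of_le hk
  rw [valueMat_add_sub hW hRt]
  exact posSemidef_congr_transpose (info_posSemidef (measCov_posDef hW) (procCov_posSemidef hRt)
    (priorCov_posSemidef hW hRt N) j) _

lemma tendsto_smoothedCov (hW : s.weight.PosDef) (hRt : s.Rt.PosDef)
    (hZ : Tendsto s.valueMat atTop (𝓝 Z)) : Tendsto s.smoothedCov atTop
      (𝓝 (s.Rt⁻¹ - s.Rt⁻¹ * sel n m * Z * (sel n m)ᵀ * s.Rt⁻¹)) := by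
  have hcont : Continuous fun A : Matrix (Fin n ⊕ Fin m) (Fin n ⊕ Fin m) ℝ =>
      s.Rt⁻¹ - s.Rt⁻¹ * sel n m * A * (sel n m)ᵀ * s.Rt⁻¹ := by fun_prop
  refine ((hcont.tendsto Z).comp ((tendsto_add_atTop_iff_nat 1).2 hZ)).congr fun N => ?_
  exact (smoothedCov_eq hW hRt N).symm

/-- The limiting smoothed covariance is the inverse of the Hessian of the Bellman equation. -/
lemma smoothedCov_limit_posDef (hW : s.weight.PosDef) (hRt : s.Rt.PosDef)
    (hZ : Tendsto s.valueMat atTop (𝓝 Z)) :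
    (s.Rt⁻¹ - s.Rt⁻¹ * sel n m * Z * (sel n m)ᵀ * s.Rt⁻¹).PosDef := by
  have hB := isBellmanStep_limit hW hRt hZ
  have heq := hB.eq
  have hUp : (s.weight + s.Phiᵀ * Z * s.Phi).PosSemidef :=
    hW.posSemidef.add (posSemidef_congr_transpose hB.posSemidef_left _)
  set U := s.weight + s.Phiᵀ * Z * s.Phi
  set E := sel n m
  have hG : (s.Rt + E * U * Eᵀ).PosDef := hRt.add_posSemidef (posSemidef_congr hUp E)
  have hmul : (s.Rt⁻¹ - s.Rt⁻¹ * E * Z * Eᵀ * s.Rt⁻¹) * (s.Rt + E * U * Eᵀ) = 1 := by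
    have e : (s.Rt⁻¹ - s.Rt⁻¹ * E * Z * Eᵀ * s.Rt⁻¹) * (s.Rt + E * U * Eᵀ)
        = s.Rt⁻¹ * s.Rt + s.Rt⁻¹ * E * (U - Z * (Eᵀ * s.Rt⁻¹ * E) * U) * Eᵀ
          - s.Rt⁻¹ * E * Z * Eᵀ * (s.Rt⁻¹ * s.Rt) := by
      simp only [Matrix.mul_add, Matrix.mul_sub, Matrix.sub_mul, Matrix.mul_assoc]
      abel
    rw [e, ← procCov_eq, ← heq, hRt.inv_mul_self_eq_one, Matrix.mul_one, sub_sub_cancel]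
    abel
  rw [← Matrix.inv_eq_left_inv hmul]
  exact hG.inv

lemma exists_norm_error_le (hW : s.weight.PosDef) (hRt : s.Rt.PosDef) {c : ℝ} (hc0 : 0 < c)
    (hc : ∀ N, ‖Z - s.valueMat N‖ ≤ c * ‖s.closedLoopProd N‖ ^ 2) :
    ∃ d : ℝ, 0 < d ∧ ∀ N,
      ‖s.Rt⁻¹ * sel n m * Z - s.Keff N‖ ≤ d * ‖s.closedLoopProd (N + 1)‖ ^ 2 ∧
      ‖s.Rt⁻¹ - s.Rt⁻¹ * sel n m * Z * (sel n m)ᵀ * s.Rt⁻¹ - s.smoothedCov N‖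
        ≤ d * ‖s.closedLoopProd (N + 1)‖ ^ 2 := by
  set a := ‖s.Rt⁻¹ * sel n m‖
  set b := ‖(sel n m)ᵀ * s.Rt⁻¹‖
  refine ⟨a * c + a * c * b + 1, by positivity, fun N => ?_⟩
  have hx : 0 ≤ ‖s.closedLoopProd (N + 1)‖ ^ 2 := by positivity
  have h1 : ‖s.Rt⁻¹ * sel n m * Z - s.Keff N‖ ≤ a * (c * ‖s.closedLoopProd (N + 1)‖ ^ 2) := by
    rw [Keff_eq hW hRt, ← Matrix.mul_sub]
    exact Matrix.l2_opNorm_mul_le le_rfl (hc (N + 1))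
  have h2 : ‖s.Rt⁻¹ - s.Rt⁻¹ * sel n m * Z * (sel n m)ᵀ * s.Rt⁻¹ - s.smoothedCov N‖
      ≤ a * (c * ‖s.closedLoopProd (N + 1)‖ ^ 2) * b := by
    have e : s.Rt⁻¹ - s.Rt⁻¹ * sel n m * Z * (sel n m)ᵀ * s.Rt⁻¹ - s.smoothedCov N
        = -((s.Rt⁻¹ * sel n m * Z - s.Keff N) * ((sel n m)ᵀ * s.Rt⁻¹)) := by
      rw [smoothedCov_eq hW hRt, Keff_eq hW hRt]
      simp only [Matrix.sub_mul, Matrix.mul_assoc]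
      abel
    rw [e, norm_neg]
    exact Matrix.l2_opNorm_mul_le h1 le_rfl
  have h3 : 0 ≤ a * c * ‖s.closedLoopProd (N + 1)‖ ^ 2 := by positivity
  have h4 : 0 ≤ a * c * b * ‖s.closedLoopProd (N + 1)‖ ^ 2 := by positivity
  constructor <;> linarith

lemma deltaP_posSemidef (hW : s.weight.PosDef) (hRt : s.Rt.PosDef) (N : ℕ) :
    (s.deltaP N).PosSemidef := by
  have h := posSemidef_congr (increment_posSemidef hW hRt N) (s.Rt⁻¹ * sel n m)
  rw [Matrix.transpose_mul, hRt.inv.posSemidef.transpose_eq] at h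
  rw [deltaP_eq hRt]
  simpa only [Matrix.mul_assoc] using h

lemma exists_sq_norm_closedLoopProd_le (hW : s.weight.PosDef) (hRt : s.Rt.PosDef)
    (hc : s.Controllable) :
    ∃ c : ℝ, 0 < c ∧ ∀ N, ‖s.closedLoopProd N‖ ^ 2
      ≤ c * ‖sel n m * ((s.closedLoopProd N)ᵀ * s.innov N * s.closedLoopProd N) * (sel n m)ᵀ‖ := by
  obtain ⟨a, ha0, ha⟩ := exists_norm_closedLoopProd_le hW hRt hc
  obtain ⟨β, hβ0, hβ⟩ := exists_sq_norm_le_innov hW hRt hc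
  refine ⟨a ^ 2 * β, by positivity, fun N => ?_⟩
  have h := hβ N (s.closedLoopProd N * (sel n m)ᵀ)
  have e : (s.closedLoopProd N * (sel n m)ᵀ)ᵀ * s.innov N * (s.closedLoopProd N * (sel n m)ᵀ)
      = sel n m * ((s.closedLoopProd N)ᵀ * s.innov N * s.closedLoopProd N) * (sel n m)ᵀ := by
    rw [Matrix.transpose_mul, Matrix.transpose_transpose]
    simp only [Matrix.mul_assoc]
  rw [e] at h
  calc ‖s.closedLoopProd N‖ ^ 2 ≤ (a * ‖s.closedLoopProd N * (sel n m)ᵀ‖) ^ 2 :=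
        pow_le_pow_left₀ (norm_nonneg _) (ha N) 2
    _ = a ^ 2 * ‖s.closedLoopProd N * (sel n m)ᵀ‖ ^ 2 := by ring
    _ ≤ a ^ 2 * (β * _) := mul_le_mul_of_nonneg_left h (by positivity)
    _ = _ := by ring

lemma exists_sq_norm_le_trace_deltaP (hW : s.weight.PosDef) (hRt : s.Rt.PosDef)
    (hc : s.Controllable) :
    ∃ c : ℝ, 0 < c ∧ ∀ N, ‖s.closedLoopProd N‖ ^ 2 ≤ c * (s.deltaP N).trace := by
  obtain ⟨a, ha0, ha⟩ := exists_sq_norm_closedLoopProd_le hW hRt hc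
  refine ⟨a * (‖s.Rt‖ * ‖s.Rt‖) + 1, by positivity, fun N => ?_⟩
  have e : sel n m * ((s.closedLoopProd N)ᵀ * s.innov N * s.closedLoopProd N) * (sel n m)ᵀ
      = s.Rt * s.deltaP N * s.Rt := by
    have e' : ∀ X : Matrix (Fin m) (Fin m) ℝ,
        s.Rt * (s.Rt⁻¹ * X * s.Rt⁻¹) * s.Rt = X := fun X => by
      have : s.Rt * (s.Rt⁻¹ * X * s.Rt⁻¹) * s.Rt = (s.Rt * s.Rt⁻¹) * X * (s.Rt⁻¹ * s.Rt) := by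
        simp only [Matrix.mul_assoc]
      rw [this, hRt.mul_inv_self_eq_one, hRt.inv_mul_self_eq_one, Matrix.one_mul, Matrix.mul_one]
    rw [deltaP_eq hRt]
    conv_lhs => rw [← e' (_ * _ * _)]
    simp only [Matrix.mul_assoc]
  have h1 : ‖s.Rt * s.deltaP N * s.Rt‖ ≤ ‖s.Rt‖ * (s.deltaP N).trace * ‖s.Rt‖ :=
    Matrix.l2_opNorm_mul_le (Matrix.l2_opNorm_mul_le le_rfl
      (deltaP_posSemidef hW hRt N).l2_opNorm_le_trace) le_rfl
  have h2 := ha N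
  rw [e] at h2
  have h3 := mul_le_mul_of_nonneg_left h1 ha0.le
  have h4 := (deltaP_posSemidef hW hRt N).trace_nonneg
  linarith

lemma exists_trace_deltaP_le (hW : s.weight.PosDef) (hRt : s.Rt.PosDef) (hc : s.Controllable) :
    ∃ c : ℝ, 0 < c ∧ ∀ N, (s.deltaP N).trace ≤ c * ‖s.closedLoopProd N‖ ^ 2 := by
  obtain ⟨t, ht0, ht⟩ := Matrix.exists_trace_le_l2_opNorm (Fin m)
  obtain ⟨b, hb0, hb⟩ := exists_norm_innov_le hW hRt hc
  set a := ‖s.Rt⁻¹ * sel n m‖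
  set d := ‖(sel n m)ᵀ * s.Rt⁻¹‖
  refine ⟨t * (a * b * d) + 1, by positivity, fun N => ?_⟩
  have h1 : ‖s.deltaP N‖ ≤ a * (‖s.closedLoopProd N‖ * b * ‖s.closedLoopProd N‖) * d := by
    rw [deltaP_eq hRt, Matrix.mul_assoc _ (sel n m)ᵀ]
    exact Matrix.l2_opNorm_mul_le (Matrix.l2_opNorm_mul_le le_rfl (Matrix.l2_opNorm_mul_le
      (Matrix.l2_opNorm_mul_le (Matrix.l2_opNorm_transpose _).le
        (hb _ (priorCov_posSemidef hW hRt N))) le_rfl)) le_rfl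
  have h2 := mul_le_mul_of_nonneg_left h1 ht0.le
  have h3 := ht (s.deltaP N)
  have h4 : 0 ≤ ‖s.closedLoopProd N‖ ^ 2 := by positivity
  linarith

/-- The remaining value Z − V_{N+1} dominates its first increment, whose control block is bounded
below by a multiple of ‖T_{N+1}‖². -/
lemma exists_sq_norm_le_gain_error (hW : s.weight.PosDef) (hRt : s.Rt.PosDef)
    (hc : s.Controllable) (hZ : Tendsto s.valueMat atTop (𝓝 Z)) :
    ∃ c : ℝ, 0 < c ∧ ∀ N,
      ‖s.closedLoopProd (N + 1)‖ ^ 2 ≤ c * ‖s.Rt⁻¹ * sel n m * Z - s.Keff N‖ := by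
  obtain ⟨a, ha0, ha⟩ := exists_sq_norm_closedLoopProd_le hW hRt hc
  obtain ⟨t, ht0, ht⟩ := Matrix.exists_trace_le_l2_opNorm (Fin m)
  refine ⟨a * (t * (‖s.Rt‖ * ‖(sel n m)ᵀ‖)) + 1, by positivity, fun N => ?_⟩
  set D := (s.closedLoopProd (N + 1))ᵀ * s.innov (N + 1) * s.closedLoopProd (N + 1)
  have hsucc : s.valueMat (N + 1 + 1) = s.valueMat (N + 1) + D := valueMat_succ hW hRt (N + 1)
  have h1 := (posSemidef_congr (increment_posSemidef hW hRt (N + 1)) (sel n m)).l2_opNorm_le_trace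
  have h2 := (posSemidef_congr (limit_sub_valueMat_posSemidef hW hRt hZ (N + 1 + 1))
    (sel n m)).trace_nonneg
  have e : sel n m * (Z - s.valueMat (N + 1 + 1)) * (sel n m)ᵀ
      = sel n m * (Z - s.valueMat (N + 1)) * (sel n m)ᵀ - sel n m * D * (sel n m)ᵀ := by
    rw [hsucc]
    simp only [Matrix.mul_sub, Matrix.mul_add, Matrix.sub_mul, Matrix.add_mul]
    abel
  rw [e, Matrix.trace_sub] at h2
  have h3 := ht (sel n m * (Z - s.valueMat (N + 1)) * (sel n m)ᵀ)
  have e2 : sel n m * (Z - s.valueMat (N + 1)) = s.Rt * (s.Rt⁻¹ * sel n m * Z - s.Keff N) := by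
    rw [Keff_eq hW hRt, ← Matrix.mul_sub, Matrix.mul_assoc s.Rt⁻¹, ← Matrix.mul_assoc s.Rt,
      hRt.mul_inv_self_eq_one, Matrix.one_mul]
  have h4 : ‖sel n m * (Z - s.valueMat (N + 1)) * (sel n m)ᵀ‖
      ≤ ‖s.Rt‖ * ‖s.Rt⁻¹ * sel n m * Z - s.Keff N‖ * ‖(sel n m)ᵀ‖ := by
    rw [e2]
    exact Matrix.l2_opNorm_mul_le (Matrix.l2_opNorm_mul_le le_rfl le_rfl) le_rfl
  have h5 := ha (N + 1)
  have h6 := mul_le_mul_of_nonneg_left h4 ht0.le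
  have h7 : ‖sel n m * D * (sel n m)ᵀ‖
      ≤ t * (‖s.Rt‖ * ‖s.Rt⁻¹ * sel n m * Z - s.Keff N‖ * ‖(sel n m)ᵀ‖) := by linarith
  have h8 := mul_le_mul_of_nonneg_left h7 ha0.le
  have h9 := norm_nonneg (s.Rt⁻¹ * sel n m * Z - s.Keff N)
  linarith

/-- Z dominates V_1 = S_0, whose control block is positive definite. -/
lemma gain_ne_zero [Nonempty (Fin m)] (hW : s.weight.PosDef) (hRt : s.Rt.PosDef)
    (hZ : Tendsto s.valueMat atTop (𝓝 Z)) : s.Rt⁻¹ * sel n m * Z ≠ 0 := by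
  intro h0
  have h1 : sel n m * Z * (sel n m)ᵀ = 0 := by
    have : sel n m * Z = s.Rt * (s.Rt⁻¹ * sel n m * Z) := by
      rw [Matrix.mul_assoc s.Rt⁻¹, ← Matrix.mul_assoc s.Rt, hRt.mul_inv_self_eq_one, Matrix.one_mul]
    rw [this, h0, Matrix.mul_zero, Matrix.zero_mul]
  have hinj : Function.Injective (Matrix.vecMul · (sel n m)) := by
    intro x y hxy
    have h := congrArg (Matrix.vecMul · (sel n m)ᵀ) hxy
    simpa [Matrix.vecMul_vecMul, sel_mul_transpose] using h
  have hS : (s.innov 0).PosDef :=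
    (posDef_add (measCov_posDef hW) (priorCov_posSemidef hW hRt 0)).inv
  have h2 : (sel n m * s.innov 0 * (sel n m)ᵀ).PosDef := by
    simpa [Matrix.conjTranspose_eq_transpose_of_trivial] using
      hS.mul_mul_conjTranspose_same hinj
  have h3 := (posSemidef_congr (limit_sub_valueMat_posSemidef hW hRt hZ 1) (sel n m)).trace_nonneg
  have e : s.valueMat 1 = s.innov 0 := by
    rw [valueMat_succ hW hRt]
    simp [valueMat, info, closedLoopProd]
  rw [e, Matrix.mul_sub, Matrix.sub_mul, h1, zero_sub, Matrix.trace_neg] at h3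
  linarith [h2.trace_pos]

lemma exists_norm_closedLoopProd_succ_le (hW : s.weight.PosDef) (hRt : s.Rt.PosDef)
    (hc : s.Controllable) :
    ∃ c : ℝ, 0 < c ∧ ∀ N, ‖s.closedLoopProd (N + 1)‖ ≤ c * ‖s.closedLoopProd N‖ := by
  obtain ⟨ℓ, hℓ, h⟩ := exists_norm_closed_priorCov_le hW hRt hc
  refine ⟨ℓ + 1, by positivity, fun N => ?_⟩
  rw [closedLoopProd, closed_priorCov hW hRt]
  refine (Matrix.l2_opNorm_mul_le (h N) le_rfl).trans ?_
  linarith [norm_nonneg (s.closedLoopProd N)]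

/-- The limiting closed loop may be singular, but its powers eventually factor through the next
power, so only the first few steps can lose rank. -/
lemma exists_norm_closedLoopProd_le_succ (hW : s.weight.PosDef) (hRt : s.Rt.PosDef)
    (hc : s.Controllable) {P : Matrix (Fin n ⊕ Fin m) (Fin n ⊕ Fin m) ℝ}
    (hP : Tendsto s.priorCov atTop (𝓝 P)) :
    ∃ c : ℝ, 0 < c ∧ ∀ᶠ N in atTop, ‖s.closedLoopProd N‖ ≤ c * ‖s.closedLoopProd (N + 1)‖ := by
  obtain ⟨a, ha0, ha⟩ := exists_norm_closedLoopProd_equiv hW hRt hc hP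
  obtain ⟨d, B, hB⟩ := Matrix.exists_pow_eq_pow_succ_mul (closed s.Phi s.measCov P)
  refine ⟨a * (a * ‖B‖) + 1, by positivity, ?_⟩
  filter_upwards [eventually_ge_atTop d] with N hN
  obtain ⟨j, rfl⟩ := Nat.exists_eq_add_of_le hN
  have e : closed s.Phi s.measCov P ^ (d + j) = closed s.Phi s.measCov P ^ (d + j + 1) * B := by
    rw [add_comm d j, pow_add, hB, ← Matrix.mul_assoc, ← pow_add, add_assoc]
  have h1 : ‖closed s.Phi s.measCov P ^ (d + j)‖
      ≤ a * ‖s.closedLoopProd (d + j + 1)‖ * ‖B‖ := by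
    conv_lhs => rw [e]
    exact Matrix.l2_opNorm_mul_le (ha (d + j + 1)).2 le_rfl
  have h2 := mul_le_mul_of_nonneg_left h1 ha0.le
  have h3 := (ha (d + j)).1
  linarith [norm_nonneg (s.closedLoopProd (d + j + 1))]

end Limit

end LqrData

/-! ### Assembly of the theorem -/

lemma le_geometric_div {x c r : ℝ} {N : ℕ} (hc : 0 ≤ c) (hr0 : 0 ≤ r) (hr1 : r < 1)
    (h : x ≤ c * r ^ (2 * N)) :
    x ≤ (c + 1) * (r ^ (2 * N) / (1 - r ^ 2)) ∧
      (0 < r → x < (c + 1) * (r ^ (2 * N) / (1 - r ^ 2))) := by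
  have h1 : r ^ 2 < 1 := pow_lt_one₀ hr0 hr1 two_ne_zero
  have h2 : r ^ (2 * N) ≤ r ^ (2 * N) / (1 - r ^ 2) :=
    le_div_self (pow_nonneg hr0 _) (by linarith) (by linarith [sq_nonneg r])
  have h3 : (c + 1) * r ^ (2 * N) ≤ (c + 1) * (r ^ (2 * N) / (1 - r ^ 2)) :=
    mul_le_mul_of_nonneg_left h2 (by linarith)
  refine ⟨?_, fun hr => ?_⟩
  · linarith [pow_nonneg hr0 (2 * N)]
  · linarith [pow_pos hr (2 * N)]

theorem corollary4 {n m : ℕ} (s : LqrData n m) (hW : s.weight.PosDef) (hRt : s.Rt.PosDef)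
    (hctrl : s.Controllable) :
    ∃ (Klqr : Matrix (Fin m) (Fin n ⊕ Fin m) ℝ)
      (Kinf : Matrix (Fin n ⊕ Fin m) (Fin n ⊕ Fin m) ℝ) (Pinf : Matrix (Fin m) (Fin m) ℝ),
      (∀ K : Matrix (Fin m) (Fin n ⊕ Fin m) ℝ, s.IsLqrGain K ↔ K = Klqr) ∧
      Tendsto s.kalmanGain atTop (𝓝 Kinf) ∧
      Tendsto s.smoothedCov atTop (𝓝 Pinf) ∧
      s.lamMax Kinf < 1 ∧
      -- the gain error against the covariance increment
      (∃ γ : ℝ, 0 < γ ∧ ∀ᶠ N in atTop,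
        ‖Klqr - s.Keff N‖ ≤ γ * (s.deltaP N).trace ∧
        (0 < s.lamMax Kinf → ‖Klqr - s.Keff N‖ < γ * (s.deltaP N).trace)) ∧
      -- geometric bounds at the rate of the dominant eigenvalue
      (s.DominantSemisimple Kinf →
        ∃ γk γp : ℝ, 0 < γk ∧ 0 < γp ∧ ∀ N : ℕ,
          ‖Klqr - s.Keff N‖ ≤ γk * (s.lamMax Kinf ^ (2 * N) / (1 - s.lamMax Kinf ^ 2)) ∧
          ‖Pinf - s.smoothedCov N‖ ≤ γp * (s.lamMax Kinf ^ (2 * N) / (1 - s.lamMax Kinf ^ 2)) ∧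
          (0 < s.lamMax Kinf →
            ‖Klqr - s.Keff N‖ < γk * (s.lamMax Kinf ^ (2 * N) / (1 - s.lamMax Kinf ^ 2)) ∧
            ‖Pinf - s.smoothedCov N‖
              < γp * (s.lamMax Kinf ^ (2 * N) / (1 - s.lamMax Kinf ^ 2)))) ∧
      -- geometric bounds at every larger rate, whatever the Jordan structure
      (∀ r : ℝ, s.lamMax Kinf < r → r < 1 →
        ∃ γk γp : ℝ, 0 < γk ∧ 0 < γp ∧ ∀ N : ℕ,
          ‖Klqr - s.Keff N‖ < γk * (r ^ (2 * N) / (1 - r ^ 2)) ∧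
          ‖Pinf - s.smoothedCov N‖ < γp * (r ^ (2 * N) / (1 - r ^ 2))) ∧
      -- the termination metric is equivalent to the relative gain error
      (∃ c₁ c₂ : ℝ, 0 < c₁ ∧ 0 < c₂ ∧ ∀ᶠ N in atTop,
        ‖Klqr - s.Keff N‖ ≤ c₁ * s.tau N * ‖Klqr‖ ∧
        s.tau N * ‖Klqr‖ ≤ c₂ * ‖Klqr - s.Keff N‖) := by
  obtain ⟨Z, hZ, cz, hcz0, hcz⟩ := LqrData.exists_tendsto_valueMat hW hRt hctrl
  obtain ⟨P, hP⟩ := LqrData.exists_tendsto_priorCov hW hRt hctrl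
  obtain ⟨d, hd0, hd⟩ := LqrData.exists_norm_error_le hW hRt hcz0 hcz
  obtain ⟨q, hq0, hq⟩ := LqrData.exists_norm_closedLoopProd_equiv hW hRt hctrl hP
  obtain ⟨p, hp0, hp⟩ := LqrData.exists_sq_norm_le_trace_deltaP hW hRt hctrl
  obtain ⟨l, hl0, hl⟩ := LqrData.exists_norm_closedLoopProd_succ_le hW hRt hctrl
  rw [LqrData.closed_limit hW hRt hP] at hq
  have hK := LqrData.tendsto_kalmanGain hW hRt hP
  have hPinf := LqrData.smoothedCov_limit_posDef hW hRt hZ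
  have hS := LqrData.tendsto_smoothedCov hW hRt hZ
  set Kinf := P * (P + s.measCov)⁻¹
  set Klqr := s.Rt⁻¹ * LqrData.sel n m * Z with hKlqr
  set Pinf := s.Rt⁻¹ - Klqr * (LqrData.sel n m)ᵀ * s.Rt⁻¹
  have hlam : s.lamMax Kinf < 1 := by
    refine LqrData.lamMax_lt_one (tendsto_zero_iff_norm_tendsto_zero.2 ?_)
    have h1 := (LqrData.tendsto_sq_norm_closedLoopProd hW hRt hctrl).sqrt.const_mul q
    simp only [Real.sqrt_sq (norm_nonneg _), Real.sqrt_zero, mul_zero] at h1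
    exact squeeze_zero (fun N => norm_nonneg _) (fun N => (hq N).2) h1
  -- gain error against the next covariance increment
  have herr : ∀ N, ‖Klqr - s.Keff N‖ ≤ d * l ^ 2 * p * (s.deltaP N).trace := fun N => by
    calc ‖Klqr - s.Keff N‖ ≤ d * ‖s.closedLoopProd (N + 1)‖ ^ 2 := (hd N).1
      _ ≤ d * (l * ‖s.closedLoopProd N‖) ^ 2 := by gcongr; exact hl N
      _ = d * l ^ 2 * ‖s.closedLoopProd N‖ ^ 2 := by ring
      _ ≤ d * l ^ 2 * (p * (s.deltaP N).trace) := by gcongr; exact hp N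
      _ = _ := by ring
  have hrate : ∀ r : ℝ, 0 ≤ r → r < 1 →
      (s.lamMax Kinf < r ∨ (s.lamMax Kinf = r ∧ s.DominantSemisimple Kinf)) →
      ∃ γ : ℝ, 0 < γ ∧ ∀ N : ℕ,
        (‖Klqr - s.Keff N‖ ≤ γ * (r ^ (2 * N) / (1 - r ^ 2)) ∧
          (0 < r → ‖Klqr - s.Keff N‖ < γ * (r ^ (2 * N) / (1 - r ^ 2)))) ∧
        (‖Pinf - s.smoothedCov N‖ ≤ γ * (r ^ (2 * N) / (1 - r ^ 2)) ∧
          (0 < r → ‖Pinf - s.smoothedCov N‖ < γ * (r ^ (2 * N) / (1 - r ^ 2)))) := by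
    intro r hr0 hr1 h
    obtain ⟨c, hc0, hc⟩ := LqrData.exists_norm_pow_le hr0 h
    refine ⟨d * (q * c) ^ 2 + 1, by positivity, fun N => ?_⟩
    have hb : d * ‖s.closedLoopProd (N + 1)‖ ^ 2 ≤ d * (q * c) ^ 2 * r ^ (2 * N) := by
      calc d * ‖s.closedLoopProd (N + 1)‖ ^ 2 ≤ d * (q * (c * r ^ N)) ^ 2 := by
            gcongr
            exact (hq (N + 1)).1.trans (mul_le_mul_of_nonneg_left (hc N) hq0.le)
        _ = _ := by ring
    have hc' : 0 ≤ d * (q * c) ^ 2 := by positivity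
    exact ⟨le_geometric_div hc' hr0 hr1 ((hd N).1.trans hb),
      le_geometric_div hc' hr0 hr1 ((hd N).2.trans hb)⟩
  refine ⟨Klqr, Kinf, Pinf,
    LqrData.isLqrGain_iff hW hRt (LqrData.isBellmanStep_limit hW hRt hZ) hZ, hK, hS, hlam,
    ?_, ?_, ?_, ?_⟩
  -- The extra 1 makes the inequality strict whenever tr ΔP_N > 0. This holds if λ_max > 0, since
  -- T_N = 0 would make the limiting closed loop nilpotent.
  · refine ⟨d * l ^ 2 * p + 1, by positivity, Eventually.of_forall fun N => ⟨?_, fun hpos => ?_⟩⟩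
    · linarith [herr N, (LqrData.deltaP_posSemidef hW hRt N).trace_nonneg]
    · have hne : 0 < ‖s.closedLoopProd N‖ := by
        refine lt_of_le_of_ne (norm_nonneg _) fun h0 => hpos.ne' ?_
        refine LqrData.lamMax_eq_zero (N := N) (norm_le_zero_iff.1 ?_)
        simpa [← h0] using (hq N).2
      have h1 : 0 < p * (s.deltaP N).trace := (pow_pos hne 2).trans_le (hp N)
      linarith [herr N, (mul_pos_iff_of_pos_left hp0).1 h1]
  · intro hss
    obtain ⟨γ, hγ0, hγ⟩ := hrate _ (LqrData.lamMax_nonneg Kinf) hlam (Or.inr ⟨rfl, hss⟩)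
    exact ⟨γ, γ, hγ0, hγ0, fun N =>
      ⟨(hγ N).1.1, (hγ N).2.1, fun h => ⟨(hγ N).1.2 h, (hγ N).2.2 h⟩⟩⟩
  · intro r hr hr1
    have hr0 : 0 < r := (LqrData.lamMax_nonneg Kinf).trans_lt hr
    obtain ⟨γ, hγ0, hγ⟩ := hrate r hr0.le hr1 (Or.inl hr)
    exact ⟨γ, γ, hγ0, hγ0, fun N => ⟨(hγ N).1.2 hr0, (hγ N).2.2 hr0⟩⟩
  · rcases isEmpty_or_nonempty (Fin m) with hm | hm
    · refine ⟨1, 1, one_pos, one_pos, Eventually.of_forall fun N => ?_⟩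
      rw [Subsingleton.elim (Klqr - s.Keff N) 0, Subsingleton.elim Klqr 0]
      simp
    obtain ⟨t, ht0, ht⟩ := LqrData.exists_trace_deltaP_le hW hRt hctrl
    obtain ⟨g, hg0, hg⟩ := LqrData.exists_sq_norm_le_gain_error hW hRt hctrl hZ
    obtain ⟨f, hf0, hf⟩ := LqrData.exists_norm_closedLoopProd_le_succ hW hRt hctrl hP
    have hKpos : 0 < ‖Klqr‖ := norm_pos_iff.2 (LqrData.gain_ne_zero hW hRt hZ)
    have hT : 0 < Pinf.trace := hPinf.trace_pos
    have hcont : Continuous fun A : Matrix (Fin m) (Fin m) ℝ => A.trace := by fun_prop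
    have hTlim : Tendsto (fun N => (s.smoothedCov N).trace) atTop (𝓝 Pinf.trace) :=
      (hcont.tendsto Pinf).comp hS
    -- The trace of the smoothed covariance eventually lies between half and twice its positive
    -- limit, which converts τ_N into tr ΔP_N.
    refine ⟨d * l ^ 2 * p * (2 * Pinf.trace) / ‖Klqr‖,
      2 / Pinf.trace * (t * f ^ 2 * g) * ‖Klqr‖, by positivity, by positivity, ?_⟩
    filter_upwards [hf, hTlim.eventually (lt_mem_nhds (half_lt_self hT)),
      hTlim.eventually (gt_mem_nhds (show Pinf.trace < 2 * Pinf.trace by linarith))]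
      with N hfN hlow hup
    have hτ : s.tau N * (s.smoothedCov N).trace = (s.deltaP N).trace :=
      div_mul_cancel₀ _ (by linarith)
    have hΔ := (LqrData.deltaP_posSemidef hW hRt N).trace_nonneg
    have hτ0 : 0 ≤ s.tau N := div_nonneg hΔ (by linarith)
    constructor
    · have e : d * l ^ 2 * p * (2 * Pinf.trace) / ‖Klqr‖ * s.tau N * ‖Klqr‖
          = d * l ^ 2 * p * (s.tau N * (2 * Pinf.trace)) := by
        field_simp
      rw [e]
      refine (herr N).trans ?_
      rw [← hτ]
      gcongr
    · have h1 : s.tau N ≤ 2 / Pinf.trace * (s.deltaP N).trace := by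
        rw [← hτ]
        have : s.tau N * (Pinf.trace / 2) ≤ s.tau N * (s.smoothedCov N).trace := by gcongr
        calc s.tau N = 2 / Pinf.trace * (s.tau N * (Pinf.trace / 2)) := by field_simp
          _ ≤ _ := by gcongr
      have h2 : (s.deltaP N).trace ≤ t * f ^ 2 * g * ‖Klqr - s.Keff N‖ := by
        calc (s.deltaP N).trace ≤ t * ‖s.closedLoopProd N‖ ^ 2 := ht N
          _ ≤ t * (f * ‖s.closedLoopProd (N + 1)‖) ^ 2 := by gcongr
          _ = t * f ^ 2 * ‖s.closedLoopProd (N + 1)‖ ^ 2 := by ring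
          _ ≤ t * f ^ 2 * (g * ‖Klqr - s.Keff N‖) := by gcongr; exact hg N
          _ = _ := by ring
      calc s.tau N * ‖Klqr‖ ≤ 2 / Pinf.trace * (t * f ^ 2 * g * ‖Klqr - s.Keff N‖) * ‖Klqr‖ := by
            refine mul_le_mul_of_nonneg_right (h1.trans ?_) hKpos.le
            exact mul_le_mul_of_nonneg_left h2 (by positivity)
        _ = _ := by ring
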